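/- Let $G$ be a finite group and let $T$ be a $G$-Tambara functor, given by commutative rings $T(G/H)$ for $H\le G$ with restrictions, transfers, norms and conjugations. A Tambara ideal $I$ of $T$ is a family of ideals $I(G/H)\subseteq T(G/H)$ closed under restrictions, transfers, norms and conjugations; it is proper if $1\notin I(G/G)$. For $x\in T(G/H)$ let $\langle x\rangle$ be the smallest Tambara ideal containing $x$, and let the product $IJ$ be the Tambara ideal generated by the levelwise products $I(G/H)J(G/H)$. The radical $\sqrt I$ is the Tambara ideal with $(\sqrt I)(G/H)=\{x\in T(G/H) : \langle x\rangle^n\subseteq I \text{ for some } n\ge 1\}$; $I$ is radical if $I=\sqrt I$, and $\mathfrak N(T)=\sqrt 0$ is the nilradical, with $T_{\mathrm{red}}=T/\mathfrak N(T)$. The radical Tambara ideals, ordered by inclusion, form a frame $\mathrm{RadId}_G(T)$ with top element $T$; let $\vee,\wedge$ be its joins and meets. The Nakaoka spectrum $\mathrm{Spec}_{\mathrm{Nak}}(T)$ is the set of prime Tambara ideals, i.e. proper ideals $P$ such that $IJ\subseteq P$ implies $I\subseteq P$ or $J\subseteq P$ for all Tambara ideals $I,J$. Its topology has the sets $\{P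 : x\in P(G/H)\}$, for $H\le G$ and $x\in T(G/H)$, as a subbasis of closed sets. Put $V(I)=\{P\in \mathrm{Spec}_{\mathrm{Nak}}(T) : I\subseteq P\}$. **Proposition (Chinese remainder theorem).** Let $I,J$ be radical Tambara ideals of $T$. Then the condition $$I\vee J=T\quad\text{and}\quad I\wedge J=\mathfrak N(T)$$ is equivalent to the condition that for every $H\le G$ $$I(G/H)+J(G/H)=T(G/H)\quad\text{and}\quad I(G/H)\cap J(G/H)=\mathrm{nil}(T(G/H)),$$ where $\mathrm{nil}$ denotes the ordinary nilradical of a commutative ring. If these conditions hold, then: (i) $I$ is a complemented element of $\mathrm{RadId}_G(T)$, with complement $J$. (ii) $V(I)$ and $V(J)$ are clopen, disjoint and cover $\mathrm{Spec}_{\mathrm{Nak}}(T)$, and the inclusions induce a homeomorphism $V(I)\sqcup V(J)\cong \mathrm{Spec}_{\mathrm{Nak}}(T)$. (iii) There is an isomorphism of Tambara functors $T_{\mathrm{red}}\cong (T/I)\times (T/J)$, compatible with the projections from $T$. -/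

import Mathlib

universe u v

/-! ### Subgroups, cosets and orbits -/

/-- The conjugate subgroup `g H g⁻¹`. -/
def conjSubgroup {G : Type u} [Group G] (g : G) (H : Subgroup G) : Subgroup G :=
  H.map (MulAut.conj g).toMonoidHom

/-- The cosets `K / H` of `H` in `K`, for subgroups `H ≤ K` of `G`, as a left `K`-set. -/
abbrev CosetsIn {G : Type u} [Group G] (H K : Subgroup G) : Type u :=
  K ⧸ H.subgroupOf K

/-- A chosen representative `γ` of a coset `γ H ∈ K / H`, as an element of `G`. -/
noncomputable def CosetsIn.rep {G : Type u} [Group G] {H K : Subgroup G}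
    (x : CosetsIn H K) : G :=
  ((Quotient.out x : K) : G)

/-- The double cosets `L \ K / H` for `H, L ≤ K`, that is, the `L`-orbits on `K / H`. -/
abbrev DoubleCosetsIn {G : Type u} [Group G] (L H K : Subgroup G) : Type u :=
  MulAction.orbitRel.Quotient (L.subgroupOf K) (CosetsIn H K)

/-- A chosen representative `γ` of a double coset `L γ H`, as an element of `G`. -/
noncomputable def DoubleCosetsIn.rep {G : Type u} [Group G] {L H K : Subgroup G}
    (q : DoubleCosetsIn L H K) : G :=
  CosetsIn.rep (Quotient.out q : CosetsIn H K)

/-- The set `Map(H / K, {a, b})`, with `true` for `a` and `false` for `b`. -/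
def Coloring {G : Type u} [Group G] (K H : Subgroup G) : Type u :=
  CosetsIn K H → Bool

instance {G : Type u} [Group G] (K H : Subgroup G) : MulAction H (Coloring K H) where
  smul h f := fun x => f (h⁻¹ • x)
  one_smul f := by
    funext x
    change f ((1 : H)⁻¹ • x) = f x
    simp
  mul_smul g h f := by
    funext x
    change f ((g * h)⁻¹ • x) = f (h⁻¹ • g⁻¹ • x)
    rw [mul_inv_rev, mul_smul]

instance {G : Type u} [Group G] [Finite G] (K H : Subgroup G) : Finite (Coloring K H) :=
  inferInstanceAs (Finite (CosetsIn K H → Bool))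

/-- The canonical projection `H / L → H / K`, for `L ≤ K ≤ H`. -/
def CosetsIn.proj {G : Type u} [Group G] {L K : Subgroup G} (hLK : L ≤ K) (H : Subgroup G) :
    CosetsIn L H → CosetsIn K H :=
  Subgroup.quotientMapOfLE (Subgroup.comap_mono hLK)

theorem CosetsIn.proj_smul {G : Type u} [Group G] {L K : Subgroup G} (hLK : L ≤ K)
    (H : Subgroup G) (h : H) (x : CosetsIn L H) :
    CosetsIn.proj hLK H (h • x) = h • CosetsIn.proj hLK H x := by
  induction x using QuotientGroup.induction_on with
  | H z => rfl

/-- The set of sections of the projection `H / L → H / K`, for `L ≤ K ≤ H`. -/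
def CosetSection {G : Type u} [Group G] {L K : Subgroup G} (hLK : L ≤ K) (H : Subgroup G) :
    Type u :=
  {s : CosetsIn K H → CosetsIn L H // ∀ x, CosetsIn.proj hLK H (s x) = x}

/-- `H` acts on sections by `(h • s)(x) = h • s (h⁻¹ • x)`. -/
instance {G : Type u} [Group G] {L K : Subgroup G} (hLK : L ≤ K) (H : Subgroup G) :
    MulAction H (CosetSection hLK H) where
  smul h s := ⟨fun x => h • s.1 (h⁻¹ • x), fun x => by
    rw [CosetsIn.proj_smul, s.2, smul_inv_smul]⟩
  one_smul s := by
    apply Subtype.ext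
    funext x
    change (1 : H) • s.1 ((1 : H)⁻¹ • x) = s.1 x
    simp
  mul_smul g h s := by
    apply Subtype.ext
    funext x
    change (g * h) • s.1 ((g * h)⁻¹ • x) = g • h • s.1 (h⁻¹ • g⁻¹ • x)
    rw [mul_inv_rev, mul_smul, mul_smul]

instance {G : Type u} [Group G] [Finite G] {L K : Subgroup G} (hLK : L ≤ K) (H : Subgroup G) :
    Finite (CosetSection hLK H) :=
  inferInstanceAs (Finite {s : CosetsIn K H → CosetsIn L H // ∀ x, CosetsIn.proj hLK H (s x) = x})

/-- The stabilizer in `H` of a point of an `H`-set, as a subgroup of `G`. -/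
def stabIn {G : Type u} [Group G] (H : Subgroup G) {X : Type u} [MulAction H X] (x : X) :
    Subgroup G :=
  (MulAction.stabilizer H x).map H.subtype

theorem stabIn_le {G : Type u} [Group G] (H : Subgroup G) {X : Type u} [MulAction H X] (x : X) :
    stabIn H x ≤ H :=
  Subgroup.map_subtype_le _

/-! ### Tambara functors -/

/-- The rings and structure maps of a `G`-Tambara functor, before any axiom: `obj H` is the
ring `T(G/H)`, and `res`, `tr`, `nm`, `conj` are restriction, transfer, norm and conjugation.
The target `T(G/gHg⁻¹)` of the conjugation `c_g` is written as `T(G/H')` with `g H g⁻¹ = H'`. -/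
structure TambaraData (G : Type u) [Group G] where
  obj : Subgroup G → Type v
  [ring : ∀ H, CommRing (obj H)]
  res : ∀ {K H : Subgroup G}, K ≤ H → obj H →+* obj K
  tr : ∀ {K H : Subgroup G}, K ≤ H → obj K →+ obj H
  nm : ∀ {K H : Subgroup G}, K ≤ H → obj K →* obj H
  conj : ∀ (g : G) {H H' : Subgroup G}, conjSubgroup g H = H' → obj H ≃+* obj H'

attribute [instance] TambaraData.ring

namespace TambaraData

variable {G : Type u} [Group G]

/-- The element `r^{γHγ⁻¹}_{L ∩ γHγ⁻¹} (c_γ a)` of `T(G/(L ∩ γHγ⁻¹))`. -/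
def twist (T : TambaraData.{u, v} G) (L : Subgroup G) {H : Subgroup G} (γ : G) (a : T.obj H) :
    T.obj (L ⊓ conjSubgroup γ H) :=
  T.res inf_le_right (T.conj γ rfl a)

/-- The summand of `N^H_K (a + b)` that belongs to `f : H / K → {a, b}` with stabilizer `H_f`:
`t^H_{H_f} (∏_{[γ] ∈ H_f \ H / K} N^{H_f}_{H_f ∩ γKγ⁻¹} (r (c_γ (f (γ K)))))`. -/
noncomputable def sumTerm (T : TambaraData.{u, v} G) {K H : Subgroup G} (a b : T.obj K)
    (f : Coloring K H) : T.obj H :=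
  T.tr (stabIn_le H f)
    (∏ᶠ q : MulAction.orbitRel.Quotient (MulAction.stabilizer H f) (CosetsIn K H),
      T.nm inf_le_left
        (T.twist (stabIn H f) (CosetsIn.rep q.out) (if f q.out = true then a else b)))

/-- The summand of `N^H_K (t^K_L x)` that belongs to a section `s` of `H / L → H / K` with
stabilizer `H_s`: `t^H_{H_s} (∏_{[γ] ∈ H_s \ H / K} N^{H_s}_{H_s ∩ δLδ⁻¹} (r (c_δ x)))`, where
`s (γ K) = δ L` (so that `H_s ∩ δLδ⁻¹ = H_s ∩ γKγ⁻¹`). -/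
noncomputable def transferTerm (T : TambaraData.{u, v} G) {L K H : Subgroup G} {hLK : L ≤ K}
    (x : T.obj L) (s : CosetSection hLK H) : T.obj H :=
  T.tr (stabIn_le H s)
    (∏ᶠ q : MulAction.orbitRel.Quotient (MulAction.stabilizer H s) (CosetsIn K H),
      T.nm inf_le_left (T.twist (stabIn H s) (CosetsIn.rep (s.1 q.out)) x))

/-- The axioms of a `G`-Tambara functor. -/
structure IsTambara (T : TambaraData.{u, v} G) : Prop where
  -- functoriality
  res_refl : ∀ {H : Subgroup G} (x : T.obj H), T.res le_rfl x = x
  tr_refl : ∀ {H : Subgroup G} (x : T.obj H), T.tr le_rfl x = x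
  nm_refl : ∀ {H : Subgroup G} (x : T.obj H), T.nm le_rfl x = x
  conj_refl : ∀ {H : Subgroup G} {g : G} (_ : g ∈ H) (h : conjSubgroup g H = H) (x : T.obj H),
    T.conj g h x = x
  res_res : ∀ {L K H : Subgroup G} (hLK : L ≤ K) (hKH : K ≤ H) (x : T.obj H),
    T.res hLK (T.res hKH x) = T.res (hLK.trans hKH) x
  tr_tr : ∀ {L K H : Subgroup G} (hLK : L ≤ K) (hKH : K ≤ H) (x : T.obj L),
    T.tr hKH (T.tr hLK x) = T.tr (hLK.trans hKH) x
  nm_nm : ∀ {L K H : Subgroup G} (hLK : L ≤ K) (hKH : K ≤ H) (x : T.obj L),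
    T.nm hKH (T.nm hLK x) = T.nm (hLK.trans hKH) x
  conj_conj : ∀ {H H' H'' : Subgroup G} (g h : G) (h₁ : conjSubgroup h H = H')
    (h₂ : conjSubgroup g H' = H'') (h₃ : conjSubgroup (g * h) H = H'') (x : T.obj H),
    T.conj g h₂ (T.conj h h₁ x) = T.conj (g * h) h₃ x
  -- compatibility with conjugation
  conj_res : ∀ {K H K' H' : Subgroup G} (g : G) (hKH : K ≤ H) (hKH' : K' ≤ H')
    (hK : conjSubgroup g K = K') (hH : conjSubgroup g H = H') (x : T.obj H),
    T.conj g hK (T.res hKH x) = T.res hKH' (T.conj g hH x)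
  conj_tr : ∀ {K H K' H' : Subgroup G} (g : G) (hKH : K ≤ H) (hKH' : K' ≤ H')
    (hK : conjSubgroup g K = K') (hH : conjSubgroup g H = H') (x : T.obj K),
    T.conj g hH (T.tr hKH x) = T.tr hKH' (T.conj g hK x)
  conj_nm : ∀ {K H K' H' : Subgroup G} (g : G) (hKH : K ≤ H) (hKH' : K' ≤ H')
    (hK : conjSubgroup g K = K') (hH : conjSubgroup g H = H') (x : T.obj K),
    T.conj g hH (T.nm hKH x) = T.nm hKH' (T.conj g hK x)
  -- additive and multiplicative double coset formulas
  res_tr : ∀ {H L K : Subgroup G} (hHK : H ≤ K) (hLK : L ≤ K) (x : T.obj H),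
    T.res hLK (T.tr hHK x) =
      ∑ᶠ q : DoubleCosetsIn L H K, T.tr inf_le_left (T.twist L q.rep x)
  res_nm : ∀ {H L K : Subgroup G} (hHK : H ≤ K) (hLK : L ≤ K) (x : T.obj H),
    T.res hLK (T.nm hHK x) =
      ∏ᶠ q : DoubleCosetsIn L H K, T.nm inf_le_left (T.twist L q.rep x)
  -- Frobenius reciprocity
  frobenius : ∀ {K H : Subgroup G} (hKH : K ≤ H) (x : T.obj H) (y : T.obj K),
    T.tr hKH (T.res hKH x * y) = x * T.tr hKH y
  -- Tambara reciprocity for sums and for transfers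
  nm_add : ∀ {K H : Subgroup G} (hKH : K ≤ H) (a b : T.obj K),
    T.nm hKH (a + b) =
      ∑ᶠ o : MulAction.orbitRel.Quotient H (Coloring K H), T.sumTerm a b o.out
  nm_tr : ∀ {L K H : Subgroup G} (hLK : L ≤ K) (hKH : K ≤ H) (x : T.obj L),
    T.nm hKH (T.tr hLK x) =
      ∑ᶠ o : MulAction.orbitRel.Quotient H (CosetSection hLK H), T.transferTerm x o.out

/-- A levelwise family of ring homomorphisms that commutes with all structure maps. -/
structure Hom (S T : TambaraData.{u, v} G) where
  map : ∀ H : Subgroup G, S.obj H →+* T.obj H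
  map_res : ∀ {K H : Subgroup G} (h : K ≤ H) (x : S.obj H),
    map K (S.res h x) = T.res h (map H x)
  map_tr : ∀ {K H : Subgroup G} (h : K ≤ H) (x : S.obj K),
    map H (S.tr h x) = T.tr h (map K x)
  map_nm : ∀ {K H : Subgroup G} (h : K ≤ H) (x : S.obj K),
    map H (S.nm h x) = T.nm h (map K x)
  map_conj : ∀ (g : G) {H H' : Subgroup G} (h : conjSubgroup g H = H') (x : S.obj H),
    map H' (S.conj g h x) = T.conj g h (map H x)

theorem map_finsum_finite {ι : Type*} [Finite ι] {A B : Type*} [AddCommMonoid A]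
    [AddCommMonoid B] (φ : A →+ B) (f : ι → A) : φ (∑ᶠ i, f i) = ∑ᶠ i, φ (f i) :=
  φ.map_finsum (Set.toFinite _)

theorem map_finprod_finite {ι : Type*} [Finite ι] {A B : Type*} [CommMonoid A]
    [CommMonoid B] (φ : A →* B) (f : ι → A) : φ (∏ᶠ i, f i) = ∏ᶠ i, φ (f i) :=
  φ.map_finprod (Set.toFinite _)

namespace Hom

variable {S T : TambaraData.{u, v} G} (φ : Hom S T)

theorem map_twist (L : Subgroup G) {H : Subgroup G} (γ : G) (a : S.obj H) :
    φ.map _ (S.twist L γ a) = T.twist L γ (φ.map H a) := by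
  simp only [twist, φ.map_res, φ.map_conj]

theorem map_sumTerm [Finite G] {K H : Subgroup G} (a b : S.obj K) (f : Coloring K H) :
    φ.map H (S.sumTerm a b f) = T.sumTerm (φ.map K a) (φ.map K b) f := by
  unfold sumTerm
  rw [φ.map_tr]
  congr 1
  refine (map_finprod_finite (φ.map _).toMonoidHom _).trans (finprod_congr fun q => ?_)
  change φ.map _ (S.nm _ _) = _
  rw [φ.map_nm, φ.map_twist]
  split_ifs <;> rfl

theorem map_transferTerm [Finite G] {L K H : Subgroup G} {hLK : L ≤ K} (x : S.obj L)
    (s : CosetSection hLK H) :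
    φ.map H (S.transferTerm x s) = T.transferTerm (φ.map L x) s := by
  unfold transferTerm
  rw [φ.map_tr]
  congr 1
  refine (map_finprod_finite (φ.map _).toMonoidHom _).trans (finprod_congr fun q => ?_)
  change φ.map _ (S.nm _ _) = _
  rw [φ.map_nm, φ.map_twist]

theorem map_res_tr_sum [Finite G] {H L K : Subgroup G} (x : S.obj H) :
    φ.map L (∑ᶠ q : DoubleCosetsIn L H K, S.tr inf_le_left (S.twist L q.rep x)) =
      ∑ᶠ q : DoubleCosetsIn L H K, T.tr inf_le_left (T.twist L q.rep (φ.map H x)) := by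
  refine (map_finsum_finite (φ.map _).toAddMonoidHom _).trans (finsum_congr fun q => ?_)
  change φ.map _ (S.tr _ _) = _
  rw [φ.map_tr, φ.map_twist]

theorem map_res_nm_prod [Finite G] {H L K : Subgroup G} (x : S.obj H) :
    φ.map L (∏ᶠ q : DoubleCosetsIn L H K, S.nm inf_le_left (S.twist L q.rep x)) =
      ∏ᶠ q : DoubleCosetsIn L H K, T.nm inf_le_left (T.twist L q.rep (φ.map H x)) := by
  refine (map_finprod_finite (φ.map _).toMonoidHom _).trans (finprod_congr fun q => ?_)
  change φ.map _ (S.nm _ _) = _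
  rw [φ.map_nm, φ.map_twist]

theorem map_nm_add_sum [Finite G] {K H : Subgroup G} (a b : S.obj K) :
    φ.map H (∑ᶠ o : MulAction.orbitRel.Quotient H (Coloring K H), S.sumTerm a b o.out) =
      ∑ᶠ o : MulAction.orbitRel.Quotient H (Coloring K H),
        T.sumTerm (φ.map K a) (φ.map K b) o.out :=
  (map_finsum_finite (φ.map _).toAddMonoidHom _).trans
    (finsum_congr fun _ => φ.map_sumTerm a b _)

theorem map_nm_tr_sum [Finite G] {L K H : Subgroup G} (hLK : L ≤ K) (x : S.obj L) :
    φ.map H (∑ᶠ o : MulAction.orbitRel.Quotient H (CosetSection hLK H), S.transferTerm x o.out) =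
      ∑ᶠ o : MulAction.orbitRel.Quotient H (CosetSection hLK H),
        T.transferTerm (φ.map L x) o.out :=
  (map_finsum_finite (φ.map _).toAddMonoidHom _).trans
    (finsum_congr fun _ => φ.map_transferTerm x _)

/-- The axioms pass to the target of a levelwise surjective homomorphism. -/
theorem isTambara_of_surjective [Finite G] (hφ : ∀ H, Function.Surjective (φ.map H))
    (hS : S.IsTambara) : T.IsTambara where
  res_refl y := by
    obtain ⟨x, rfl⟩ := hφ _ y
    rw [← φ.map_res, hS.res_refl]
  tr_refl y := by
    obtain ⟨x, rfl⟩ := hφ _ y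
    rw [← φ.map_tr, hS.tr_refl]
  nm_refl y := by
    obtain ⟨x, rfl⟩ := hφ _ y
    rw [← φ.map_nm, hS.nm_refl]
  conj_refl hg h y := by
    obtain ⟨x, rfl⟩ := hφ _ y
    rw [← φ.map_conj, hS.conj_refl hg]
  res_res h₁ h₂ y := by
    obtain ⟨x, rfl⟩ := hφ _ y
    simp only [← φ.map_res, hS.res_res]
  tr_tr h₁ h₂ y := by
    obtain ⟨x, rfl⟩ := hφ _ y
    simp only [← φ.map_tr, hS.tr_tr]
  nm_nm h₁ h₂ y := by
    obtain ⟨x, rfl⟩ := hφ _ y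
    simp only [← φ.map_nm, hS.nm_nm]
  conj_conj g h h₁ h₂ h₃ y := by
    obtain ⟨x, rfl⟩ := hφ _ y
    simp only [← φ.map_conj, hS.conj_conj g h h₁ h₂ h₃]
  conj_res g h h' hK hH y := by
    obtain ⟨x, rfl⟩ := hφ _ y
    rw [← φ.map_res, ← φ.map_conj, ← φ.map_conj, ← φ.map_res, hS.conj_res g h h' hK hH]
  conj_tr g h h' hK hH y := by
    obtain ⟨x, rfl⟩ := hφ _ y
    rw [← φ.map_tr, ← φ.map_conj, ← φ.map_conj, ← φ.map_tr, hS.conj_tr g h h' hK hH]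
  conj_nm g h h' hK hH y := by
    obtain ⟨x, rfl⟩ := hφ _ y
    rw [← φ.map_nm, ← φ.map_conj, ← φ.map_conj, ← φ.map_nm, hS.conj_nm g h h' hK hH]
  res_tr hHK hLK y := by
    obtain ⟨x, rfl⟩ := hφ _ y
    rw [← φ.map_tr, ← φ.map_res, hS.res_tr hHK hLK, φ.map_res_tr_sum]
  res_nm hHK hLK y := by
    obtain ⟨x, rfl⟩ := hφ _ y
    rw [← φ.map_nm, ← φ.map_res, hS.res_nm hHK hLK, φ.map_res_nm_prod]
  frobenius h y z := by
    obtain ⟨x, rfl⟩ := hφ _ y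
    obtain ⟨w, rfl⟩ := hφ _ z
    rw [← φ.map_res, ← φ.map_tr, ← map_mul, ← map_mul, ← φ.map_tr, hS.frobenius]
  nm_add h y z := by
    obtain ⟨x, rfl⟩ := hφ _ y
    obtain ⟨w, rfl⟩ := hφ _ z
    rw [← map_add, ← φ.map_nm, hS.nm_add, φ.map_nm_add_sum]
  nm_tr hLK hKH y := by
    obtain ⟨x, rfl⟩ := hφ _ y
    rw [← φ.map_tr, ← φ.map_nm, hS.nm_tr, φ.map_nm_tr_sum]

end Hom

/-- The levelwise product. -/
def prod (S T : TambaraData.{u, v} G) : TambaraData.{u, v} G where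
  obj H := S.obj H × T.obj H
  res h := (S.res h).prodMap (T.res h)
  tr h := (S.tr h).prodMap (T.tr h)
  nm h := (S.nm h).prodMap (T.nm h)
  conj g _ _ h := (S.conj g h).prodCongr (T.conj g h)

/-- The first projection. -/
def prodFst (S T : TambaraData.{u, v} G) : Hom (S.prod T) S where
  map H := RingHom.fst (S.obj H) (T.obj H)
  map_res _ _ := rfl
  map_tr _ _ := rfl
  map_nm _ _ := rfl
  map_conj _ _ _ _ _ := rfl

/-- The second projection. -/
def prodSnd (S T : TambaraData.{u, v} G) : Hom (S.prod T) T where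
  map H := RingHom.snd (S.obj H) (T.obj H)
  map_res _ _ := rfl
  map_tr _ _ := rfl
  map_nm _ _ := rfl
  map_conj _ _ _ _ _ := rfl

theorem IsTambara.prod [Finite G] {S T : TambaraData.{u, v} G} (hS : S.IsTambara)
    (hT : T.IsTambara) : (S.prod T).IsTambara where
  res_refl x := Prod.ext (hS.res_refl x.1) (hT.res_refl x.2)
  tr_refl x := Prod.ext (hS.tr_refl x.1) (hT.tr_refl x.2)
  nm_refl x := Prod.ext (hS.nm_refl x.1) (hT.nm_refl x.2)
  conj_refl hg h x := Prod.ext (hS.conj_refl hg h x.1) (hT.conj_refl hg h x.2)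
  res_res h₁ h₂ x := Prod.ext (hS.res_res h₁ h₂ x.1) (hT.res_res h₁ h₂ x.2)
  tr_tr h₁ h₂ x := Prod.ext (hS.tr_tr h₁ h₂ x.1) (hT.tr_tr h₁ h₂ x.2)
  nm_nm h₁ h₂ x := Prod.ext (hS.nm_nm h₁ h₂ x.1) (hT.nm_nm h₁ h₂ x.2)
  conj_conj g h h₁ h₂ h₃ x :=
    Prod.ext (hS.conj_conj g h h₁ h₂ h₃ x.1) (hT.conj_conj g h h₁ h₂ h₃ x.2)
  conj_res g h h' hK hH x :=
    Prod.ext (hS.conj_res g h h' hK hH x.1) (hT.conj_res g h h' hK hH x.2)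
  conj_tr g h h' hK hH x :=
    Prod.ext (hS.conj_tr g h h' hK hH x.1) (hT.conj_tr g h h' hK hH x.2)
  conj_nm g h h' hK hH x :=
    Prod.ext (hS.conj_nm g h h' hK hH x.1) (hT.conj_nm g h h' hK hH x.2)
  res_tr hHK hLK x :=
    Prod.ext ((hS.res_tr hHK hLK x.1).trans ((prodFst S T).map_res_tr_sum x).symm)
      ((hT.res_tr hHK hLK x.2).trans ((prodSnd S T).map_res_tr_sum x).symm)
  res_nm hHK hLK x :=
    Prod.ext ((hS.res_nm hHK hLK x.1).trans ((prodFst S T).map_res_nm_prod x).symm)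
      ((hT.res_nm hHK hLK x.2).trans ((prodSnd S T).map_res_nm_prod x).symm)
  frobenius h x y := Prod.ext (hS.frobenius h x.1 y.1) (hT.frobenius h x.2 y.2)
  nm_add h x y :=
    Prod.ext ((hS.nm_add h x.1 y.1).trans ((prodFst S T).map_nm_add_sum x y).symm)
      ((hT.nm_add h x.2 y.2).trans ((prodSnd S T).map_nm_add_sum x y).symm)
  nm_tr hLK hKH x :=
    Prod.ext ((hS.nm_tr hLK hKH x.1).trans ((prodFst S T).map_nm_tr_sum hLK x).symm)
      ((hT.nm_tr hLK hKH x.2).trans ((prodSnd S T).map_nm_tr_sum hLK x).symm)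

end TambaraData

/-- A `G`-Tambara functor. -/
structure TambaraFunctor (G : Type u) [Group G] extends TambaraData.{u, v} G where
  isTambara : toTambaraData.IsTambara

/-! ### Tambara ideals -/

/-- An ideal of a Tambara functor: an ideal of each ring `T(G/H)`, closed under restriction,
transfer, norm and conjugation (the conjugation `c_g` carries `I(G/H)` onto `I(G/gHg⁻¹)`). -/
@[ext]
structure TambaraIdeal {G : Type u} [Group G] (T : TambaraFunctor.{u, v} G) where
  carrier : ∀ H : Subgroup G, Ideal (T.obj H)
  res_mem : ∀ {K H : Subgroup G} (h : K ≤ H) {x : T.obj H}, x ∈ carrier H → T.res h x ∈ carrier K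
  tr_mem : ∀ {K H : Subgroup G} (h : K ≤ H) {x : T.obj K}, x ∈ carrier K → T.tr h x ∈ carrier H
  nm_mem : ∀ {K H : Subgroup G} (h : K ≤ H) {x : T.obj K}, x ∈ carrier K → T.nm h x ∈ carrier H
  conj_mem_iff : ∀ (g : G) {H H' : Subgroup G} (h : conjSubgroup g H = H') {x : T.obj H},
    T.conj g h x ∈ carrier H' ↔ x ∈ carrier H

namespace TambaraIdeal

variable {G : Type u} [Group G] {T : TambaraFunctor.{u, v} G}

/-- Inclusion of ideals. -/
instance : PartialOrder (TambaraIdeal T) :=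
  PartialOrder.lift TambaraIdeal.carrier fun _ _ h => TambaraIdeal.ext h

theorem le_def {I J : TambaraIdeal T} : I ≤ J ↔ ∀ H, I.carrier H ≤ J.carrier H :=
  Iff.rfl

/-- The levelwise intersection. -/
instance : InfSet (TambaraIdeal T) where
  sInf S :=
    { carrier := fun H => ⨅ I ∈ S, I.carrier H
      res_mem := fun h x hx => by
        simp only [Submodule.mem_iInf] at hx ⊢
        exact fun I hI => I.res_mem h (hx I hI)
      tr_mem := fun h x hx => by
        simp only [Submodule.mem_iInf] at hx ⊢
        exact fun I hI => I.tr_mem h (hx I hI)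
      nm_mem := fun h x hx => by
        simp only [Submodule.mem_iInf] at hx ⊢
        exact fun I hI => I.nm_mem h (hx I hI)
      conj_mem_iff := fun g _ _ h x => by
        simp only [Submodule.mem_iInf]
        exact forall₂_congr fun I _ => I.conj_mem_iff g h }

theorem mem_sInf {S : Set (TambaraIdeal T)} {H : Subgroup G} {x : T.obj H} :
    x ∈ (sInf S).carrier H ↔ ∀ I ∈ S, x ∈ I.carrier H := by
  change x ∈ ⨅ I ∈ S, I.carrier H ↔ _
  simp only [Submodule.mem_iInf]

theorem sInf_le_of_mem {S : Set (TambaraIdeal T)} {I : TambaraIdeal T} (h : I ∈ S) :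
    sInf S ≤ I :=
  fun _ _ hx => mem_sInf.1 hx I h

theorem le_sInf_of_le {S : Set (TambaraIdeal T)} {I : TambaraIdeal T} (h : ∀ J ∈ S, I ≤ J) :
    I ≤ sInf S :=
  fun H _ hx => mem_sInf.2 fun J hJ => h J hJ H hx

/-- The whole Tambara functor as an ideal. -/
instance : Top (TambaraIdeal T) where
  top :=
    { carrier := fun _ => ⊤
      res_mem := fun _ _ _ => Submodule.mem_top
      tr_mem := fun _ _ _ => Submodule.mem_top
      nm_mem := fun _ _ _ => Submodule.mem_top
      conj_mem_iff := fun _ _ _ _ _ => ⟨fun _ => Submodule.mem_top, fun _ => Submodule.mem_top⟩ }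

theorem mem_top {H : Subgroup G} (x : T.obj H) : x ∈ (⊤ : TambaraIdeal T).carrier H :=
  Submodule.mem_top (R := T.obj H)

theorem twist_mem (I : TambaraIdeal T) (L : Subgroup G) {H : Subgroup G} (γ : G) {a : T.obj H}
    (ha : a ∈ I.carrier H) : T.twist L γ a ∈ I.carrier _ :=
  I.res_mem _ ((I.conj_mem_iff γ rfl).2 ha)

theorem finsum_mem {ι : Type*} {R : Type*} [CommRing R] (I : Ideal R) {f : ι → R}
    (h : ∀ i, f i ∈ I) : ∑ᶠ i, f i ∈ I :=
  finsum_induction (· ∈ I) I.zero_mem (fun _ _ => I.add_mem) h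

theorem finprod_mem {ι : Type*} [Finite ι] {R : Type*} [CommRing R] (I : Ideal R) {f : ι → R}
    (i : ι) (h : f i ∈ I) : ∏ᶠ i, f i ∈ I := by
  classical
  have := Fintype.ofFinite ι
  rw [finprod_eq_prod_of_fintype]
  exact I.prod_mem (Finset.mem_univ i) h

theorem sumTerm_mem [Finite G] (I : TambaraIdeal T) {K H : Subgroup G} (a b : T.obj K)
    (f : Coloring K H)
    (q : MulAction.orbitRel.Quotient (MulAction.stabilizer H f) (CosetsIn K H))
    (h : (if f q.out = true then a else b) ∈ I.carrier K) : T.sumTerm a b f ∈ I.carrier H :=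
  I.tr_mem _ (finprod_mem _ q (I.nm_mem _ (I.twist_mem _ _ h)))

/-- Norms of congruent elements are congruent. -/
theorem nm_sub_mem [Finite G] (I : TambaraIdeal T) {K H : Subgroup G} (h : K ≤ H) {a b : T.obj K}
    (hab : a - b ∈ I.carrier K) : T.nm h a - T.nm h b ∈ I.carrier H := by
  classical
  obtain ⟨i, hi, rfl⟩ : ∃ i, i ∈ I.carrier K ∧ a = b + i := ⟨a - b, hab, by ring⟩
  have h0 : T.nm h b = T.nm h (b + 0) := by rw [add_zero]
  rw [h0, T.isTambara.nm_add, T.isTambara.nm_add,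
    ← finsum_sub_distrib (Set.toFinite _) (Set.toFinite _)]
  refine finsum_mem _ fun o => ?_
  by_cases hq : ∃ q : MulAction.orbitRel.Quotient (MulAction.stabilizer H o.out) (CosetsIn K H),
      ¬ (o.out : Coloring K H) q.out = true
  · obtain ⟨q, hq⟩ := hq
    refine (I.carrier H).sub_mem (I.sumTerm_mem _ _ _ q ?_) (I.sumTerm_mem _ _ _ q ?_)
    · rw [if_neg hq]
      exact hi
    · rw [if_neg hq]
      exact Submodule.zero_mem _
  · push Not at hq
    have : T.sumTerm b i o.out = T.sumTerm b 0 o.out := by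
      unfold TambaraData.sumTerm
      simp only [hq, if_true]
    rw [this, sub_self]
    exact Submodule.zero_mem _

/-- The levelwise sum of two ideals. -/
def add [Finite G] (I J : TambaraIdeal T) : TambaraIdeal T where
  carrier H := I.carrier H ⊔ J.carrier H
  res_mem h x hx := by
    obtain ⟨a, ha, b, hb, rfl⟩ := Submodule.mem_sup.1 hx
    rw [map_add]
    exact Submodule.add_mem_sup (I.res_mem h ha) (J.res_mem h hb)
  tr_mem h x hx := by
    obtain ⟨a, ha, b, hb, rfl⟩ := Submodule.mem_sup.1 hx
    rw [map_add]
    exact Submodule.add_mem_sup (I.tr_mem h ha) (J.tr_mem h hb)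
  nm_mem {K H} h x hx := by
    obtain ⟨a, ha, b, hb, rfl⟩ := Submodule.mem_sup.1 hx
    rw [show T.nm h (a + b) = T.nm h a + (T.nm h (a + b) - T.nm h a) by ring]
    refine Submodule.add_mem_sup (I.nm_mem h ha) (J.nm_sub_mem h ?_)
    simpa using hb
  conj_mem_iff g H H' h x := by
    constructor
    · intro hx
      obtain ⟨a, ha, b, hb, hab⟩ := Submodule.mem_sup.1 hx
      have : x = (T.conj g h).symm a + (T.conj g h).symm b := by
        rw [← map_add, hab, RingEquiv.symm_apply_apply]
      rw [this]
      refine Submodule.add_mem_sup ((I.conj_mem_iff g h).1 ?_) ((J.conj_mem_iff g h).1 ?_)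
      · rwa [RingEquiv.apply_symm_apply]
      · rwa [RingEquiv.apply_symm_apply]
    · intro hx
      obtain ⟨a, ha, b, hb, rfl⟩ := Submodule.mem_sup.1 hx
      rw [map_add]
      exact Submodule.add_mem_sup ((I.conj_mem_iff g h).2 ha) ((J.conj_mem_iff g h).2 hb)

/-- The ideal `⟨x⟩` generated by `x ∈ T(G/H)`. -/
def span {H : Subgroup G} (x : T.obj H) : TambaraIdeal T :=
  sInf {I | x ∈ I.carrier H}

theorem mem_span {H : Subgroup G} (x : T.obj H) : x ∈ (span x).carrier H :=
  mem_sInf.2 fun _ h => h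

theorem span_le {H : Subgroup G} {x : T.obj H} {I : TambaraIdeal T} :
    span x ≤ I ↔ x ∈ I.carrier H :=
  ⟨fun h => h H (mem_span x), fun h => sInf_le_of_mem h⟩

/-- The product `IJ`: the ideal generated by the levelwise products `I(G/H) · J(G/H)`. -/
instance : Mul (TambaraIdeal T) where
  mul I J := sInf {M | ∀ H, I.carrier H * J.carrier H ≤ M.carrier H}

theorem mul_le {I J M : TambaraIdeal T} :
    I * J ≤ M ↔ ∀ H, ∀ x ∈ I.carrier H, ∀ y ∈ J.carrier H, x * y ∈ M.carrier H := by
  constructor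
  · intro h H x hx y hy
    exact h H (mem_sInf.2 fun N hN => hN H (Ideal.mul_mem_mul hx hy))
  · intro h
    exact sInf_le_of_mem fun H => Ideal.mul_le.2 (h H)

theorem mul_mem {I J : TambaraIdeal T} {H : Subgroup G} {x y : T.obj H} (hx : x ∈ I.carrier H)
    (hy : y ∈ J.carrier H) : x * y ∈ (I * J).carrier H :=
  mul_le.1 le_rfl H x hx y hy

/-- The `n`-fold product `Iⁿ = I ⋯ I` (with `I⁰ = T`, so that `I¹ = I`). -/
def npow (I : TambaraIdeal T) : ℕ → TambaraIdeal T
  | 0 => ⊤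
  | n + 1 => npow I n * I

theorem npow_one (I : TambaraIdeal T) : I.npow 1 = I := by
  refine le_antisymm (mul_le.2 fun H x _ y hy => Ideal.mul_mem_left _ x hy) fun H x hx => ?_
  have := mul_mem (I := (⊤ : TambaraIdeal T)) (J := I) (mem_top (1 : T.obj H)) hx
  rwa [one_mul] at this

theorem npow_mono {I J : TambaraIdeal T} (h : I ≤ J) (n : ℕ) : I.npow n ≤ J.npow n := by
  induction n with
  | zero => exact le_rfl
  | succ n ih => exact mul_le.2 fun H x hx y hy => mul_mem (ih H hx) (h H hy)

theorem npow_antitone (I : TambaraIdeal T) : Antitone I.npow :=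
  antitone_nat_of_succ_le fun _ => mul_le.2 fun _ _ hx y _ => Ideal.mul_mem_right y _ hx

theorem le_add_left' [Finite G] (I J : TambaraIdeal T) : I ≤ I.add J :=
  fun _ _ hx => Submodule.mem_sup_left hx

theorem le_add_right' [Finite G] (I J : TambaraIdeal T) : J ≤ I.add J :=
  fun _ _ hx => Submodule.mem_sup_right hx

/-- The sum of the ideals `F 0, …, F n`. -/
def sumUpTo [Finite G] (F : ℕ → TambaraIdeal T) : ℕ → TambaraIdeal T
  | 0 => F 0
  | n + 1 => (sumUpTo F n).add (F (n + 1))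

theorem le_sumUpTo [Finite G] (F : ℕ → TambaraIdeal T) {i n : ℕ} (h : i ≤ n) :
    F i ≤ sumUpTo F n := by
  induction n with
  | zero =>
    obtain rfl : i = 0 := by omega
    exact le_rfl
  | succ n ih =>
    rcases Nat.lt_or_ge n i with h' | h'
    · obtain rfl : i = n + 1 := by omega
      exact le_add_right' _ _
    · exact (ih h').trans (le_add_left' _ _)

theorem sumUpTo_mul_mem [Finite G] (F : ℕ → TambaraIdeal T) {n : ℕ} {M : TambaraIdeal T}
    {H : Subgroup G} {y : T.obj H}
    (h : ∀ i ≤ n, ∀ x ∈ (F i).carrier H, x * y ∈ M.carrier H) {x : T.obj H}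
    (hx : x ∈ (sumUpTo F n).carrier H) : x * y ∈ M.carrier H := by
  induction n generalizing x with
  | zero => exact h 0 le_rfl x hx
  | succ n ih =>
    obtain ⟨a, ha, b, hb, rfl⟩ := Submodule.mem_sup.1 hx
    rw [add_mul]
    exact Submodule.add_mem _ (ih (fun i hi => h i (by omega)) ha) (h (n + 1) le_rfl b hb)

theorem npow_add_le [Finite G] {I A B : TambaraIdeal T} {n m : ℕ} (hA : A.npow n ≤ I)
    (hB : B.npow m ≤ I) : (A.add B).npow (n + m) ≤ I := by
  let F : ℕ → ℕ → TambaraIdeal T := fun k i => sInf {A.npow i, B.npow (k - i)}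
  have hF : ∀ {k i : ℕ} {H : Subgroup G} {x : T.obj H}, x ∈ (F k i).carrier H ↔
      x ∈ (A.npow i).carrier H ∧ x ∈ (B.npow (k - i)).carrier H := by
    intro k i H x
    change x ∈ (sInf {A.npow i, B.npow (k - i)} : TambaraIdeal T).carrier H ↔ _
    rw [mem_sInf]
    simp
  have key : ∀ k, (A.add B).npow k ≤ sumUpTo (F k) k := by
    intro k
    induction k with
    | zero => exact fun H x _ => hF.2 ⟨mem_top x, mem_top x⟩
    | succ k ih =>
      refine mul_le.2 fun H x hx y hy => sumUpTo_mul_mem _ (fun i hi z hz => ?_) (ih H hx)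
      obtain ⟨hzA, hzB⟩ := hF.1 hz
      obtain ⟨a, ha, b, hb, rfl⟩ := Submodule.mem_sup.1 hy
      rw [mul_add]
      refine Submodule.add_mem _ (le_sumUpTo _ (i := i + 1) (by omega) H (hF.2 ⟨mul_mem hzA ha, ?_⟩))
        (le_sumUpTo _ (i := i) (by omega) H (hF.2 ⟨Ideal.mul_mem_right _ _ hzA, ?_⟩))
      · rw [show k + 1 - (i + 1) = k - i by omega]
        exact Ideal.mul_mem_right _ _ hzB
      · rw [show k + 1 - i = (k - i) + 1 by omega]
        exact mul_mem hzB hb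
  intro H x hx
  rw [← mul_one x]
  refine sumUpTo_mul_mem _ (fun i hi z hz => ?_) (key _ H hx)
  rw [mul_one]
  obtain ⟨hzA, hzB⟩ := hF.1 hz
  by_cases h : n ≤ i
  · exact hA H (A.npow_antitone h H hzA)
  · exact hB H (B.npow_antitone (by omega) H hzB)

theorem span_npow_le {H K : Subgroup G} {x : T.obj H} {y : T.obj K} {I : TambaraIdeal T} {n : ℕ}
    (hx : (span x).npow n ≤ I) (hy : y ∈ (span x).carrier K) : (span y).npow n ≤ I :=
  (npow_mono (span_le.2 hy) n).trans hx

/-- The radical: `x ∈ √I (G/H)` if and only if `⟨x⟩ⁿ ⊆ I` for some `n ≥ 1`. -/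
def radical [Finite G] (I : TambaraIdeal T) : TambaraIdeal T where
  carrier H :=
    { carrier := {x | ∃ n : ℕ, 1 ≤ n ∧ (span x).npow n ≤ I}
      zero_mem' := ⟨1, le_rfl, by
        rw [npow_one]
        exact span_le.2 (Submodule.zero_mem _)⟩
      add_mem' := by
        rintro x y ⟨n, hn, hx⟩ ⟨m, hm, hy⟩
        refine ⟨n + m, by omega, (npow_mono (span_le.2 ?_) _).trans (npow_add_le hx hy)⟩
        exact Submodule.add_mem_sup (mem_span x) (mem_span y)
      smul_mem' := by
        rintro c x ⟨n, hn, hx⟩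
        exact ⟨n, hn, span_npow_le hx (Submodule.smul_mem _ c (mem_span x))⟩ }
  res_mem := by
    rintro K H h x ⟨n, hn, hx⟩
    exact ⟨n, hn, span_npow_le hx (res_mem _ h (mem_span x))⟩
  tr_mem := by
    rintro K H h x ⟨n, hn, hx⟩
    exact ⟨n, hn, span_npow_le hx (tr_mem _ h (mem_span x))⟩
  nm_mem := by
    rintro K H h x ⟨n, hn, hx⟩
    exact ⟨n, hn, span_npow_le hx (nm_mem _ h (mem_span x))⟩
  conj_mem_iff := by
    intro g H H' h x
    constructor
    · rintro ⟨n, hn, hx⟩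
      exact ⟨n, hn, span_npow_le hx ((conj_mem_iff _ g h).1 (mem_span _))⟩
    · rintro ⟨n, hn, hx⟩
      exact ⟨n, hn, span_npow_le hx ((conj_mem_iff _ g h).2 (mem_span x))⟩

theorem le_radical [Finite G] (I : TambaraIdeal T) : I ≤ I.radical := fun H x hx =>
  ⟨1, le_rfl, by
    rw [npow_one]
    exact span_le.2 hx⟩

/-- An ideal is radical if it equals its radical. -/
def IsRadical [Finite G] (I : TambaraIdeal T) : Prop :=
  I = I.radical

theorem isRadical_sInf [Finite G] {S : Set (TambaraIdeal T)} (hS : ∀ I ∈ S, I.IsRadical) :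
    (sInf S).IsRadical := by
  refine le_antisymm (le_radical _) fun H x hx => mem_sInf.2 fun I hI => ?_
  obtain ⟨n, hn, hx⟩ := hx
  rw [hS I hI]
  exact ⟨n, hn, hx.trans (sInf_le_of_mem hI)⟩

theorem isRadical_top [Finite G] : (⊤ : TambaraIdeal T).IsRadical :=
  le_antisymm (le_radical _) fun _ x _ => mem_top x

/-- A proper ideal `P` is prime if `IJ ⊆ P` implies `I ⊆ P` or `J ⊆ P`. -/
structure IsPrime (P : TambaraIdeal T) : Prop where
  one_notMem : (1 : T.obj ⊤) ∉ P.carrier ⊤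
  le_or_le : ∀ I J : TambaraIdeal T, I * J ≤ P → I ≤ P ∨ J ≤ P

end TambaraIdeal

/-! ### The zero ideal, quotients, products and isomorphisms -/

namespace TambaraFunctor

variable {G : Type u} [Group G]

theorem conjSubgroup_le {g : G} {K H : Subgroup G} (hg : g ∈ H) (hKH : K ≤ H) :
    conjSubgroup g K ≤ H := by
  rintro _ ⟨k, hk, rfl⟩
  exact H.mul_mem (H.mul_mem hg (hKH hk)) (H.inv_mem hg)

theorem conjSubgroup_self {g : G} {H : Subgroup G} (hg : g ∈ H) : conjSubgroup g H = H := by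
  refine le_antisymm (conjSubgroup_le hg le_rfl) fun x hx => ?_
  refine ⟨g⁻¹ * x * g, H.mul_mem (H.mul_mem (H.inv_mem hg) hx) hg, ?_⟩
  simp [mul_assoc]

theorem nm_conj_zero (T : TambaraFunctor.{u, v} G) {K H M : Subgroup G} (h : K ≤ H) {g : G}
    (hg : g ∈ H) (hM : conjSubgroup g K = M) (hMH : M ≤ H) :
    T.nm hMH (0 : T.obj M) = T.nm h 0 := by
  have := T.isTambara.conj_nm g h hMH hM (conjSubgroup_self hg) 0
  rw [T.isTambara.conj_refl hg, map_zero (T.conj g hM)] at this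
  exact this.symm

theorem sumTerm_zero_of_top (T : TambaraFunctor.{u, v} G) {K H : Subgroup G} (h : K ≤ H)
    (f : Coloring K H) (hf : MulAction.stabilizer H f = ⊤) :
    T.sumTerm (0 : T.obj K) 0 f = T.nm h 0 := by
  have hS : stabIn H f = H := by
    unfold stabIn
    rw [hf, ← MonoidHom.range_eq_map, Subgroup.range_subtype]
  have key : ∀ (P : Subgroup H) (S : Subgroup G) (hSH : S ≤ H), P = ⊤ → S = H →
      T.tr hSH (∏ᶠ q : MulAction.orbitRel.Quotient P (CosetsIn K H),
        T.nm (inf_le_left : S ⊓ conjSubgroup (CosetsIn.rep q.out) K ≤ S) 0) = T.nm h 0 := by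
    rintro P S hSH rfl rfl
    rw [T.isTambara.tr_refl]
    have hsub : Subsingleton (MulAction.orbitRel.Quotient (⊤ : Subgroup S) (CosetsIn K S)) := by
      refine ⟨fun x y => ?_⟩
      induction x using Quotient.inductionOn
      rename_i x
      induction y using Quotient.inductionOn
      rename_i y
      obtain ⟨g, hg⟩ := MulAction.exists_smul_eq S y x
      exact Quotient.sound ⟨⟨g, Subgroup.mem_top g⟩, hg⟩
    let q0 : MulAction.orbitRel.Quotient (⊤ : Subgroup S) (CosetsIn K S) :=
      Quotient.mk _ (QuotientGroup.mk 1)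
    rw [finprod_eq_single _ q0 fun x hx => absurd (Subsingleton.elim x q0) hx]
    have hmem : CosetsIn.rep (Quotient.out q0 : CosetsIn K S) ∈ S := SetLike.coe_mem _
    exact T.nm_conj_zero h hmem (inf_eq_right.2 (conjSubgroup_le hmem h)).symm inf_le_left
  rw [← key _ _ (stabIn_le H f) hf hS]
  unfold TambaraData.sumTerm TambaraData.twist
  simp only [ite_self, map_zero]

theorem nm_zero [Finite G] (T : TambaraFunctor.{u, v} G) {K H : Subgroup G} (h : K ≤ H) :
    T.nm h (0 : T.obj K) = 0 := by
  classical
  induction hn : Nat.card H using Nat.strong_induction_on generalizing K H with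
  | _ n ih =>
  subst hn
  -- the constant functions are the only ones with full stabilizer
  let cst (c : Bool) : Coloring K H := fun _ => c
  have hconst : ∀ c : Bool, ∀ g : H, g • cst c = cst c := fun _ _ => rfl
  have hterm : ∀ f : Coloring K H, MulAction.stabilizer H f ≠ ⊤ →
      T.sumTerm (0 : T.obj K) 0 f = 0 := by
    intro f hf
    have hlt : Nat.card (stabIn H f) < Nat.card H := by
      refine lt_of_le_of_ne (Subgroup.card_le_of_le (stabIn_le H f)) fun hcard => hf ?_
      have hS : stabIn H f = H := Subgroup.eq_of_le_of_card_ge (stabIn_le H f) hcard.ge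
      refine eq_top_iff.2 fun g _ => ?_
      have hg : (g : G) ∈ stabIn H f := hS.symm ▸ g.2
      obtain ⟨g', hg', hgg'⟩ := hg
      rwa [← Subtype.ext hgg']
    have hfac : ∀ q : MulAction.orbitRel.Quotient (MulAction.stabilizer H f) (CosetsIn K H),
        T.nm inf_le_left (T.twist (stabIn H f) (CosetsIn.rep q.out)
          (if f q.out = true then (0 : T.obj K) else 0)) = 0 := by
      intro q
      unfold TambaraData.twist
      rw [ite_self, map_zero, map_zero]
      exact ih _ hlt _ rfl
    unfold TambaraData.sumTerm
    have := Fintype.ofFinite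
      (MulAction.orbitRel.Quotient (MulAction.stabilizer H f) (CosetsIn K H))
    rw [finprod_eq_prod_of_fintype, Finset.prod_eq_zero
      (Finset.mem_univ (Quotient.mk _ (QuotientGroup.mk 1))) (hfac _), map_zero]
  have hout : ∀ c : Bool, (Quotient.mk _ (cst c) :
      MulAction.orbitRel.Quotient H (Coloring K H)).out = cst c := by
    intro c
    obtain ⟨g, hg⟩ := Quotient.mk_out (s := MulAction.orbitRel H (Coloring K H))
      (cst c)
    exact hg.symm.trans (hconst c g)
  let o (c : Bool) : MulAction.orbitRel.Quotient H (Coloring K H) :=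
    Quotient.mk _ (cst c)
  have ho : o true ≠ o false := by
    intro heq
    have h1 := hout true
    have h2 := hout false
    change (o true).out = _ at h1
    change (o false).out = _ at h2
    rw [heq, h2] at h1
    exact absurd (congrFun h1 (QuotientGroup.mk 1)) (by simp [cst])
  have hval : ∀ c, T.sumTerm (0 : T.obj K) 0 (o c).out = T.nm h 0 := by
    intro c
    refine T.sumTerm_zero_of_top h _ (eq_top_iff.2 fun g _ => ?_)
    change g • (o c).out = (o c).out
    rw [show (o c).out = cst c from hout c]
    exact hconst c g
  have hother : ∀ x, x ≠ o true ∧ x ≠ o false → T.sumTerm (0 : T.obj K) 0 x.out = 0 := by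
    rintro x ⟨h1, h2⟩
    refine hterm _ fun hst => ?_
    have hc : x.out = cst (x.out (QuotientGroup.mk 1)) := by
      funext y
      obtain ⟨g, hg⟩ := MulAction.exists_smul_eq H y (QuotientGroup.mk 1 : CosetsIn K H)
      have hgst : g⁻¹ ∈ MulAction.stabilizer H (x.out : Coloring K H) := hst.symm ▸ Subgroup.mem_top _
      have hfix : g⁻¹ • (x.out : Coloring K H) = x.out := MulAction.mem_stabilizer_iff.1 hgst
      have := congrFun hfix y
      change x.out (g⁻¹⁻¹ • y) = x.out y at this
      rw [inv_inv, hg] at this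
      exact this.symm
    have hx : x = o (x.out (QuotientGroup.mk 1)) := by
      conv_lhs => rw [← Quotient.out_eq x, hc]
    cases hb : x.out (QuotientGroup.mk 1) with
    | true => exact h1 (hb ▸ hx)
    | false => exact h2 (hb ▸ hx)
  have hsum := T.isTambara.nm_add h (0 : T.obj K) 0
  have := Fintype.ofFinite (MulAction.orbitRel.Quotient H (Coloring K H))
  rw [add_zero, finsum_eq_sum_of_fintype, Fintype.sum_eq_add _ _ ho hother, hval, hval] at hsum
  simpa using hsum

end TambaraFunctor

namespace TambaraIdeal

variable {G : Type u} [Group G] {T : TambaraFunctor.{u, v} G}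

/-- The zero ideal. -/
instance [Finite G] : Bot (TambaraIdeal T) where
  bot :=
    { carrier := fun _ => ⊥
      res_mem := fun h x hx => by
        rw [Ideal.mem_bot] at hx ⊢
        rw [hx, map_zero]
      tr_mem := fun h x hx => by
        rw [Ideal.mem_bot] at hx ⊢
        rw [hx, map_zero]
      nm_mem := fun h x hx => by
        rw [Ideal.mem_bot] at hx ⊢
        rw [hx, T.nm_zero]
      conj_mem_iff := fun g _ _ h x => by
        rw [Ideal.mem_bot, Ideal.mem_bot]
        exact map_eq_zero_iff _ (T.conj g h).injective }

theorem conj_map_eq (I : TambaraIdeal T) (g : G) {H H' : Subgroup G}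
    (h : conjSubgroup g H = H') :
    I.carrier H' = (I.carrier H).map (T.conj g h : T.obj H →+* T.obj H') := by
  refine le_antisymm (fun x hx => ?_) (Ideal.map_le_iff_le_comap.2 fun x hx => ?_)
  · obtain ⟨y, rfl⟩ := (T.conj g h).surjective x
    exact Ideal.mem_map_of_mem (T.conj g h : T.obj H →+* T.obj H') ((I.conj_mem_iff g h).1 hx)
  · exact (I.conj_mem_iff g h).2 hx

end TambaraIdeal

namespace TambaraFunctor

variable {G : Type u} [Group G]

/-- The rings `T(G/H) / I(G/H)` with the induced structure maps. -/
def quotientData [Finite G] (T : TambaraFunctor.{u, v} G) (I : TambaraIdeal T) :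
    TambaraData.{u, v} G where
  obj H := T.obj H ⧸ I.carrier H
  res {K H} h := Ideal.quotientMap (I.carrier K) (T.res h) fun _ hx => I.res_mem h hx
  tr {K H} h := QuotientAddGroup.map (I.carrier K).toAddSubgroup (I.carrier H).toAddSubgroup
    (T.tr h) fun _ hx => I.tr_mem h hx
  nm {K H} h :=
    { toFun := Quotient.lift (fun x => Ideal.Quotient.mk (I.carrier H) (T.nm h x))
        fun a b hab => Ideal.Quotient.eq.2
          (I.nm_sub_mem h (Ideal.Quotient.eq.1 (Quotient.sound hab)))
      map_one' := by
        change Ideal.Quotient.mk (I.carrier H) (T.nm h 1) = 1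
        rw [map_one, map_one]
      map_mul' := by
        rintro ⟨a⟩ ⟨b⟩
        change Ideal.Quotient.mk (I.carrier H) (T.nm h (a * b)) =
          Ideal.Quotient.mk (I.carrier H) (T.nm h a) * Ideal.Quotient.mk (I.carrier H) (T.nm h b)
        rw [map_mul, map_mul] }
  conj g {H H'} h :=
    Ideal.quotientEquiv (I.carrier H) (I.carrier H') (T.conj g h) (I.conj_map_eq g h)

/-- The levelwise quotient map. -/
def quotientHom [Finite G] (T : TambaraFunctor.{u, v} G) (I : TambaraIdeal T) :
    TambaraData.Hom T.toTambaraData (T.quotientData I) where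
  map H := Ideal.Quotient.mk (I.carrier H)
  map_res _ _ := rfl
  map_tr _ _ := rfl
  map_nm _ _ := rfl
  map_conj _ _ _ _ _ := rfl

/-- The quotient Tambara functor `T / I`. -/
def quotient [Finite G] (T : TambaraFunctor.{u, v} G) (I : TambaraIdeal T) :
    TambaraFunctor.{u, v} G where
  toTambaraData := T.quotientData I
  isTambara := (T.quotientHom I).isTambara_of_surjective
    (fun _ => Ideal.Quotient.mk_surjective) T.isTambara

/-- The projection `T → T / I`. -/
def toQuotient [Finite G] (T : TambaraFunctor.{u, v} G) (I : TambaraIdeal T) :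
    TambaraData.Hom T.toTambaraData (T.quotient I).toTambaraData :=
  T.quotientHom I

/-- The product of two Tambara functors, formed levelwise. -/
def prod [Finite G] (S T : TambaraFunctor.{u, v} G) : TambaraFunctor.{u, v} G where
  toTambaraData := S.toTambaraData.prod T.toTambaraData
  isTambara := S.isTambara.prod T.isTambara

/-- An isomorphism of Tambara functors: a morphism, bijective at every level. -/
structure Iso (S T : TambaraFunctor.{u, v} G) extends
    TambaraData.Hom S.toTambaraData T.toTambaraData where
  bijective : ∀ H : Subgroup G, Function.Bijective (map H)

/-- The nilradical `𝔑(T) = √0`. -/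
def nilradical [Finite G] (T : TambaraFunctor.{u, v} G) : TambaraIdeal T :=
  (⊥ : TambaraIdeal T).radical

/-- The reduction `T / 𝔑(T)`. -/
def reduction [Finite G] (T : TambaraFunctor.{u, v} G) : TambaraFunctor.{u, v} G :=
  T.quotient T.nilradical

end TambaraFunctor

/-! ### Radical ideals and the Nakaoka spectrum -/

/-- The poset of radical Tambara ideals, ordered by inclusion. -/
def RadicalTambaraIdeal {G : Type u} [Group G] [Finite G] (T : TambaraFunctor.{u, v} G) :
    Type (max u v) :=
  {I : TambaraIdeal T // I.IsRadical}

namespace RadicalTambaraIdeal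

variable {G : Type u} [Group G] [Finite G] {T : TambaraFunctor.{u, v} G}

instance : PartialOrder (RadicalTambaraIdeal T) :=
  inferInstanceAs (PartialOrder {I : TambaraIdeal T // I.IsRadical})

instance : InfSet (RadicalTambaraIdeal T) where
  sInf S := ⟨sInf (Subtype.val '' S), TambaraIdeal.isRadical_sInf (by
    rintro _ ⟨I, _, rfl⟩
    exact I.2)⟩

theorem isGLB_sInf (S : Set (RadicalTambaraIdeal T)) : IsGLB S (sInf S) :=
  ⟨fun I hI => TambaraIdeal.sInf_le_of_mem ⟨I, hI, rfl⟩,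
    fun I hI => TambaraIdeal.le_sInf_of_le (by
      rintro _ ⟨J, hJ, rfl⟩
      exact hI hJ)⟩

/-- The complete lattice of radical ideals: its order is inclusion, arbitrary meets are levelwise
intersections, the top element is `T`, and the join of a family is the smallest radical ideal that
contains every member. -/
instance : CompleteLattice (RadicalTambaraIdeal T) where
  __ := completeLatticeOfInf (RadicalTambaraIdeal T) isGLB_sInf
  top := ⟨⊤, TambaraIdeal.isRadical_top⟩
  le_top _ _ x _ := TambaraIdeal.mem_top x

end RadicalTambaraIdeal

/-- The Nakaoka spectrum: the set of prime Tambara ideals. -/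
def NakaokaSpec {G : Type u} [Group G] (T : TambaraFunctor.{u, v} G) : Type (max u v) :=
  {P : TambaraIdeal T // P.IsPrime}

namespace NakaokaSpec

variable {G : Type u} [Group G] {T : TambaraFunctor.{u, v} G}

/-- The topology for which the sets `V_H(x) = {P | x ∈ P(G/H)}` form a subbasis of closed sets. -/
instance : TopologicalSpace (NakaokaSpec T) :=
  TopologicalSpace.generateFrom
    {U | ∃ (H : Subgroup G) (x : T.obj H), U = {P : NakaokaSpec T | x ∈ P.1.carrier H}ᶜ}

/-- The set `V(I)` of the primes that contain `I`. -/
def zeroLocus (I : TambaraIdeal T) : Set (NakaokaSpec T) :=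
  {P | I ≤ P.1}

end NakaokaSpec

/-! ### Conjugation of subgroups -/

section conjSubgroup

variable {G : Type u} [Group G]

/-! The two sets of conditions are compared one half at a time, and the only deep input is that
$\mathfrak N(T)$ is computed levelwise: a nilpotent $x\in T(G/H)$ generates a nilpotent Tambara
ideal (`exists_span_npow_le_bot`, `nilradical_carrier`).

To see this, take the multiples of the elements $N^L_A(r(c_g x))$. This family `generatedBy x` is
closed under restriction, norm and conjugation, and the levelwise ideals spanned by transfers of its
elements form a Tambara ideal (`transferIdeal`) containing $x$. Closure under restriction is the
double coset formula, closure under transfer is Frobenius reciprocity, and closure under norm is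
Tambara reciprocity together with an induction on the order of the subgroup. Frobenius reciprocity
and the double coset formula also show that products of such ideals are spanned by transfers of
products. So it suffices that, at each level, products of many elements of `generatedBy x` vanish.
As $G$ is finite, at each level they are multiples of finitely many elements, all nilpotent because
norms are multiplicative and send $0$ to $0$; the ideal that these generate is therefore nilpotent.

For the joins, $I+J$ taken levelwise is already a Tambara ideal. If it is proper, Zorn's lemma puts
it inside a maximal proper ideal, which is radical, so $I\vee J\ne T$ (`sup_eq_top_iff`). Meets are
levelwise intersections.

The consequences are then formal. A prime is radical, so it contains $\mathfrak N(T)\supseteq IJ$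
and hence $I$ or $J$, but never both; and the ring-theoretic Chinese remainder theorem applies at
every level. -/

theorem conjSubgroup_mul (g h : G) (H : Subgroup G) :
    conjSubgroup (g * h) H = conjSubgroup g (conjSubgroup h H) := by
  unfold conjSubgroup
  rw [Subgroup.map_map]
  congr 1
  ext x
  simp [mul_assoc]

theorem conjSubgroup_mono (g : G) {K H : Subgroup G} (h : K ≤ H) :
    conjSubgroup g K ≤ conjSubgroup g H :=
  Subgroup.map_mono h

theorem conjSubgroup_one (H : Subgroup G) : conjSubgroup 1 H = H :=
  TambaraFunctor.conjSubgroup_self H.one_mem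

theorem conjSubgroup_inv_of_eq {g : G} {H H' : Subgroup G} (h : conjSubgroup g H = H') :
    conjSubgroup g⁻¹ H' = H := by
  rw [← h, ← conjSubgroup_mul, inv_mul_cancel, conjSubgroup_one]

theorem card_conjSubgroup (g : G) (H : Subgroup G) :
    Nat.card (conjSubgroup g H) = Nat.card H :=
  (Nat.card_congr (H.equivMapOfInjective _ (MulAut.conj g).injective).toEquiv).symm

end conjSubgroup

/-! ### Twisted restrictions, and norms of nilpotent elements -/

namespace TambaraFunctor

variable {G : Type u} [Group G] (T : TambaraFunctor.{u, v} G)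

theorem conj_inv_conj {g : G} {H H' : Subgroup G} (h : conjSubgroup g H = H') (x : T.obj H) :
    T.conj g⁻¹ (conjSubgroup_inv_of_eq h) (T.conj g h x) = x := by
  have h3 : conjSubgroup (g⁻¹ * g) H = H := by rw [inv_mul_cancel, conjSubgroup_one]
  rw [T.isTambara.conj_conj _ _ _ _ h3]
  exact T.isTambara.conj_refl (by simp) _ _

/-- Elements of the form $r(c_g a)$ are stable under the twists that occur in the double coset and
reciprocity formulas; only $g$ and the subgroup change. This is what lets inductions over such
elements close up. -/
theorem twist_res_conj (L : Subgroup G) (γ g : G) {A K K' : Subgroup G} (hA : A ≤ K')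
    (hK : conjSubgroup g K = K') (a : T.obj K) :
    T.twist L γ (T.res hA (T.conj g hK a)) =
      T.res (inf_le_right.trans (conjSubgroup_mono γ hA))
        (T.conj (γ * g) ((conjSubgroup_mul γ g K).trans (congrArg _ hK)) a) := by
  unfold TambaraData.twist
  rw [T.isTambara.conj_res γ hA (conjSubgroup_mono γ hA) rfl rfl,
    T.isTambara.conj_conj _ _ _ _ ((conjSubgroup_mul γ g K).trans (congrArg _ hK)),
    T.isTambara.res_res]

theorem isNilpotent_nm [Finite G] {K H : Subgroup G} (h : K ≤ H) {x : T.obj K}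
    (hx : IsNilpotent x) : IsNilpotent (T.nm h x) := by
  obtain ⟨n, hn⟩ := hx
  exact ⟨n, by rw [← map_pow, hn, T.nm_zero]⟩

end TambaraFunctor

/-! ### Tambara ideals spanned by transfers -/

/-- A family of subsets `D(G/H) ⊆ T(G/H)` closed under restrictions, norms, conjugations and
multiplication by arbitrary elements (but not necessarily under sums or transfers). -/
structure NormSystem {G : Type u} [Group G] (T : TambaraFunctor.{u, v} G) where
  carrier : ∀ H : Subgroup G, Set (T.obj H)
  res_mem : ∀ {K H : Subgroup G} (h : K ≤ H) {x : T.obj H}, x ∈ carrier H → T.res h x ∈ carrier K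
  nm_mem : ∀ {K H : Subgroup G} (h : K ≤ H) {x : T.obj K}, x ∈ carrier K → T.nm h x ∈ carrier H
  conj_mem : ∀ (g : G) {H H' : Subgroup G} (h : conjSubgroup g H = H') {x : T.obj H},
    x ∈ carrier H → T.conj g h x ∈ carrier H'
  mul_mem : ∀ {H : Subgroup G} (c : T.obj H) {x : T.obj H}, x ∈ carrier H → c * x ∈ carrier H

namespace NormSystem

variable {G : Type u} [Group G] {T : TambaraFunctor.{u, v} G} (D E : NormSystem T)

theorem mem_of_dvd {H : Subgroup G} {x y : T.obj H} (hx : x ∈ D.carrier H) (h : x ∣ y) :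
    y ∈ D.carrier H := by
  obtain ⟨c, rfl⟩ := h
  rw [mul_comm]
  exact D.mul_mem c hx

theorem twist_mem (L : Subgroup G) {H : Subgroup G} (γ : G) {a : T.obj H}
    (ha : a ∈ D.carrier H) : T.twist L γ a ∈ D.carrier _ :=
  D.res_mem _ (D.conj_mem γ rfl ha)

theorem dvd_finprod {ι : Type*} [Finite ι] {R : Type*} [CommRing R] (f : ι → R) (i : ι) :
    f i ∣ ∏ᶠ i, f i := by
  classical
  have := Fintype.ofFinite ι
  rw [finprod_eq_prod_of_fintype]
  exact Finset.dvd_prod_of_mem f (Finset.mem_univ i)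

/-- A single factor in `D` is enough, since `D` absorbs multiplication; nonemptiness excludes the
empty product $1$. -/
theorem finprod_mem {ι : Type*} [Finite ι] [Nonempty ι] {H : Subgroup G} {f : ι → T.obj H}
    (h : ∀ i, f i ∈ D.carrier H) : ∏ᶠ i, f i ∈ D.carrier H :=
  D.mem_of_dvd (h (Classical.arbitrary ι)) (dvd_finprod f _)

instance nonempty_orbits {α X : Type*} [Group α] [MulAction α X] [Nonempty X] :
    Nonempty (MulAction.orbitRel.Quotient α X) :=
  ‹Nonempty X›.map (Quotient.mk _)

/-- The ideal of `T(G/H)` spanned by the transfers of elements of `D`. -/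
def transferSpan (H : Subgroup G) : Ideal (T.obj H) :=
  Ideal.span {y | ∃ (L : Subgroup G) (h : L ≤ H), ∃ d ∈ D.carrier L, y = T.tr h d}

theorem tr_mem_transferSpan {L H : Subgroup G} (h : L ≤ H) {d : T.obj L}
    (hd : d ∈ D.carrier L) : T.tr h d ∈ D.transferSpan H :=
  Ideal.subset_span ⟨L, h, d, hd, rfl⟩

theorem transferSpan_le {H : Subgroup G} {I : Ideal (T.obj H)}
    (h : ∀ {L : Subgroup G} (hL : L ≤ H) {d : T.obj L}, d ∈ D.carrier L → T.tr hL d ∈ I) :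
    D.transferSpan H ≤ I :=
  Ideal.span_le.2 (by
    rintro _ ⟨L, hL, d, hd, rfl⟩
    exact h hL hd)

theorem res_mem_transferSpan {K H : Subgroup G} (h : K ≤ H) {x : T.obj H}
    (hx : x ∈ D.transferSpan H) : T.res h x ∈ D.transferSpan K := by
  refine D.transferSpan_le (I := (D.transferSpan K).comap (T.res h)) (fun hL d hd => ?_) hx
  rw [Ideal.mem_comap, T.isTambara.res_tr]
  exact TambaraIdeal.finsum_mem _ fun q => D.tr_mem_transferSpan _ (D.twist_mem _ _ hd)

theorem conj_mem_transferSpan (g : G) {H H' : Subgroup G} (h : conjSubgroup g H = H')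
    {x : T.obj H} (hx : x ∈ D.transferSpan H) : T.conj g h x ∈ D.transferSpan H' := by
  refine D.transferSpan_le (I := (D.transferSpan H').comap (T.conj g h : T.obj H →+* T.obj H'))
    (fun {L} hL d hd => ?_) hx
  change T.conj g h (T.tr hL d) ∈ D.transferSpan H'
  rw [T.isTambara.conj_tr g hL (h ▸ conjSubgroup_mono g hL) rfl]
  exact D.tr_mem_transferSpan _ (D.conj_mem g rfl hd)

theorem tr_mem_transferSpan_of_mem {K H : Subgroup G} (h : K ≤ H) {x : T.obj K}
    (hx : x ∈ D.transferSpan K) : T.tr h x ∈ D.transferSpan H := by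
  -- Transfer is not linear over $T(G/K)$, so the multiplier $r$ is carried through the induction;
  -- on a generator Frobenius reciprocity absorbs it into `D`.
  suffices ∀ r : T.obj K, T.tr h (r * x) ∈ D.transferSpan H by simpa using this 1
  induction hx using Submodule.span_induction with
  | mem x hx =>
    obtain ⟨L, hL, d, hd, rfl⟩ := hx
    intro r
    rw [← T.isTambara.frobenius, T.isTambara.tr_tr]
    exact D.tr_mem_transferSpan _ (D.mul_mem _ hd)
  | zero => simp
  | add x y _ _ hx hy =>
    intro r
    rw [mul_add, map_add]
    exact add_mem (hx r) (hy r)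
  | smul a x _ hx =>
    intro r
    rw [smul_eq_mul, ← mul_assoc]
    exact hx _

/-- By Tambara reciprocity the norm of a transfer is a sum of transfers of products of norms of
twists of $d$, and these products lie in `D`. -/
theorem nm_tr_mem_transferSpan [Finite G] {L K H : Subgroup G} (hLK : L ≤ K) (hKH : K ≤ H)
    {d : T.obj L} (hd : d ∈ D.carrier L) : T.nm hKH (T.tr hLK d) ∈ D.transferSpan H := by
  rw [T.isTambara.nm_tr]
  exact TambaraIdeal.finsum_mem _ fun o => D.tr_mem_transferSpan _
    (D.finprod_mem fun q => D.nm_mem _ (D.twist_mem _ _ hd))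

/-- Closure under norms, strengthened to norms of $r(c_g a)$ because reciprocity for $N(a+b)$
produces exactly such elements. The outer induction is on $|K|$, the inner one on the expression of
$a$ as a combination of transfers. -/
theorem nm_res_conj_mem_transferSpan [Finite G] {K : Subgroup G} {a : T.obj K}
    (ha : a ∈ D.transferSpan K) (g : G) {K' : Subgroup G} (hK : conjSubgroup g K = K')
    {L M : Subgroup G} (hL : L ≤ K') (hM : L ≤ M) :
    T.nm hM (T.res hL (T.conj g hK a)) ∈ D.transferSpan M := by
  induction hn : Nat.card K using Nat.strong_induction_on generalizing K g K' L M with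
  | _ n ih =>
  subst hn
  induction ha using Submodule.span_induction generalizing g K' L M with
  | mem a ha =>
    obtain ⟨B, hB, d, hd, rfl⟩ := ha
    -- Without a proper restriction, the element is again a transfer from `D` and reciprocity for
    -- transfers applies. A proper restriction is in general no longer a single generator, but it
    -- lives on a smaller subgroup, where the outer induction hypothesis holds for the whole span.
    rcases eq_or_lt_of_le hL with rfl | hlt
    · rw [T.isTambara.res_refl, T.isTambara.conj_tr g hB (hK ▸ conjSubgroup_mono g hB) rfl]
      exact D.nm_tr_mem_transferSpan _ _ (D.conj_mem g rfl hd)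
    · have hcard : Nat.card L < Nat.card K := by
        rw [← card_conjSubgroup g K, hK]
        exact Set.Finite.card_lt_card (Set.toFinite _) hlt
      have := ih _ hcard (D.res_mem_transferSpan hL
        (D.conj_mem_transferSpan g hK (D.tr_mem_transferSpan hB hd))) 1 (conjSubgroup_one L)
        le_rfl hM rfl
      rwa [T.isTambara.conj_refl L.one_mem, T.isTambara.res_refl] at this
  | zero =>
    rw [map_zero, map_zero, T.nm_zero]
    exact zero_mem _
  | add x y _ _ hx hy =>
    rw [map_add, map_add, T.isTambara.nm_add]
    -- Each summand is a transfer of a product, and one factor in the ideal suffices; the factor of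
    -- the orbit of the trivial coset is used.
    refine TambaraIdeal.finsum_mem _ fun o => D.tr_mem_transferSpan_of_mem _
      (TambaraIdeal.finprod_mem _ (Quotient.mk _ (QuotientGroup.mk 1)) ?_)
    split_ifs
    · rw [T.twist_res_conj]
      exact hx _ _ _ _
    · rw [T.twist_res_conj]
      exact hy _ _ _ _
  | smul r x _ hx =>
    rw [smul_eq_mul, map_mul, map_mul, map_mul]
    exact Ideal.mul_mem_left _ _ (hx _ _ _ _)

/-- The Tambara ideal spanned levelwise by the transfers of elements of `D`. -/
def transferIdeal [Finite G] : TambaraIdeal T where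
  carrier := D.transferSpan
  res_mem h _ hx := D.res_mem_transferSpan h hx
  tr_mem h _ hx := D.tr_mem_transferSpan_of_mem h hx
  nm_mem {K _} h x hx := by
    have := D.nm_res_conj_mem_transferSpan hx 1 (conjSubgroup_one K) le_rfl h
    rwa [T.isTambara.conj_refl K.one_mem, T.isTambara.res_refl] at this
  conj_mem_iff g _ _ h x :=
    ⟨fun hx => by
      rw [← T.conj_inv_conj h x]
      exact D.conj_mem_transferSpan _ _ hx, fun hx => D.conj_mem_transferSpan g h hx⟩

theorem mem_transferIdeal [Finite G] {H : Subgroup G} {x : T.obj H} (hx : x ∈ D.carrier H) :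
    x ∈ D.transferIdeal.carrier H := by
  rw [← T.isTambara.tr_refl x]
  exact D.tr_mem_transferSpan le_rfl hx

/-- The products of an element of `D` and an element of `E`. -/
def mul : NormSystem T where
  carrier H := {x | ∃ d ∈ D.carrier H, ∃ e ∈ E.carrier H, x = d * e}
  res_mem := by
    rintro K H h _ ⟨d, hd, e, he, rfl⟩
    exact ⟨_, D.res_mem h hd, _, E.res_mem h he, map_mul _ _ _⟩
  nm_mem := by
    rintro K H h _ ⟨d, hd, e, he, rfl⟩
    exact ⟨_, D.nm_mem h hd, _, E.nm_mem h he, map_mul _ _ _⟩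
  conj_mem := by
    rintro g H H' h _ ⟨d, hd, e, he, rfl⟩
    exact ⟨_, D.conj_mem g h hd, _, E.conj_mem g h he, map_mul _ _ _⟩
  mul_mem := by
    rintro H c _ ⟨d, hd, e, he, rfl⟩
    exact ⟨_, D.mul_mem c hd, e, he, (mul_assoc _ _ _).symm⟩

/-- One has $t(d)\,t(e)=t(d\cdot r\,t(e))$ by Frobenius reciprocity. The double coset formula
expands $r\,t(e)$ as a sum of transfers of twists of $e$, and a second use of Frobenius reciprocity
moves $d$ inside each of them. -/
theorem transferIdeal_mul_le [Finite G] :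
    D.transferIdeal * E.transferIdeal ≤ (D.mul E).transferIdeal := by
  refine TambaraIdeal.mul_le.2 fun H x hx y hy => ?_
  suffices D.transferSpan H * E.transferSpan H ≤ (D.mul E).transferSpan H from
    this (Ideal.mul_mem_mul hx hy)
  unfold transferSpan
  rw [Ideal.span_mul_span', Ideal.span_le]
  rintro _ ⟨_, ⟨L, hL, d, hd, rfl⟩, _, ⟨M, hM, e, he, rfl⟩, rfl⟩
  change T.tr hL d * T.tr hM e ∈ (D.mul E).transferSpan H
  rw [mul_comm, ← T.isTambara.frobenius, T.isTambara.res_tr]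
  refine (D.mul E).tr_mem_transferSpan_of_mem _ ?_
  change AddMonoidHom.mulRight d _ ∈ _
  rw [TambaraData.map_finsum_finite]
  refine TambaraIdeal.finsum_mem _ fun q => ?_
  change T.tr _ _ * d ∈ _
  rw [mul_comm, ← T.isTambara.frobenius]
  exact (D.mul E).tr_mem_transferSpan _ ⟨_, D.res_mem _ hd, _, E.twist_mem _ _ he, rfl⟩

/-- The products of `n` elements of `D`. -/
def npow : ℕ → NormSystem T
  | 0 =>
    { carrier := fun _ => Set.univ
      res_mem := fun _ _ _ => trivial
      nm_mem := fun _ _ _ => trivial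
      conj_mem := fun _ _ _ _ _ _ => trivial
      mul_mem := fun _ _ _ => trivial }
  | n + 1 => (npow n).mul D

theorem npow_transferIdeal_le [Finite G] (n : ℕ) :
    D.transferIdeal.npow n ≤ (D.npow n).transferIdeal := by
  induction n with
  | zero => exact fun H x _ => (D.npow 0).mem_transferIdeal trivial
  | succ n ih =>
    exact (TambaraIdeal.mul_le.2 fun H x hx y hy =>
      TambaraIdeal.mul_mem (ih H hx) hy).trans ((D.npow n).transferIdeal_mul_le D)

theorem npow_subset {H : Subgroup G} {J : Ideal (T.obj H)} (hJ : D.carrier H ⊆ J) (n : ℕ) :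
    (D.npow n).carrier H ⊆ (J ^ n : Ideal (T.obj H)) := by
  induction n with
  | zero => simp
  | succ n ih =>
    rintro _ ⟨d, hd, e, he, rfl⟩
    rw [pow_succ]
    exact Ideal.mul_mem_mul (ih hd) (hJ he)

/-- The multiples of the elements `N^L_A (r (c_g x))`. -/
def generatedBy [Finite G] {H : Subgroup G} (x : T.obj H) : NormSystem T where
  carrier L := {y | ∃ (A H' : Subgroup G) (g : G) (hg : conjSubgroup g H = H') (hA : A ≤ H')
    (hL : A ≤ L), T.nm hL (T.res hA (T.conj g hg x)) ∣ y}
  res_mem := by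
    rintro L' L h y ⟨A, H', g, hg, hA, hL, hy⟩
    -- The restriction of the norm is a product over double cosets. Since the family consists of
    -- multiples, keeping any one factor is enough.
    let q : DoubleCosetsIn L' A L := Classical.arbitrary _
    refine ⟨_, _, q.rep * g, (conjSubgroup_mul q.rep g H).trans (congrArg _ hg),
      inf_le_right.trans (conjSubgroup_mono q.rep hA), inf_le_left, ?_⟩
    refine dvd_trans ?_ (map_dvd (T.res h) hy)
    rw [T.isTambara.res_nm, ← T.twist_res_conj L' q.rep g hA hg]
    exact dvd_finprod _ q
  nm_mem := by
    rintro L L' h y ⟨A, H', g, hg, hA, hL, hy⟩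
    refine ⟨A, H', g, hg, hA, hL.trans h, ?_⟩
    rw [← T.isTambara.nm_nm hL h]
    exact map_dvd (T.nm h) hy
  conj_mem := by
    rintro k L L' h y ⟨A, H', g, hg, hA, hL, hy⟩
    refine ⟨_, _, k * g, (conjSubgroup_mul k g H).trans (congrArg _ hg),
      conjSubgroup_mono k hA, h ▸ conjSubgroup_mono k hL, ?_⟩
    have := map_dvd (T.conj k h) hy
    rwa [T.isTambara.conj_nm k hL (h ▸ conjSubgroup_mono k hL) rfl h,
      T.isTambara.conj_res k hA (conjSubgroup_mono k hA) rfl rfl,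
      T.isTambara.conj_conj _ _ _ _ ((conjSubgroup_mul k g H).trans (congrArg _ hg))] at this
  mul_mem := by
    rintro L c y ⟨A, H', g, hg, hA, hL, hy⟩
    exact ⟨A, H', g, hg, hA, hL, hy.mul_left c⟩

theorem self_mem_generatedBy [Finite G] {H : Subgroup G} (x : T.obj H) :
    x ∈ (generatedBy x).carrier H :=
  ⟨H, H, 1, conjSubgroup_one H, le_rfl, le_rfl, by
    rw [T.isTambara.nm_refl, T.isTambara.res_refl, T.isTambara.conj_refl H.one_mem]⟩

/-- There are only finitely many pairs $(A,g)$, so finitely many nilpotent elements generate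
everything at level $L$, and a finitely generated ideal of nilpotents is nilpotent. -/
theorem exists_isNilpotent_ideal_generatedBy [Finite G] {H : Subgroup G} {x : T.obj H}
    (hx : IsNilpotent x) (L : Subgroup G) :
    ∃ J : Ideal (T.obj L), (generatedBy x).carrier L ⊆ J ∧ IsNilpotent J := by
  let f : {p : Subgroup G × G // p.1 ≤ conjSubgroup p.2 H ∧ p.1 ≤ L} → T.obj L := fun p =>
    T.nm p.2.2 (T.res p.2.1 (T.conj p.1.2 rfl x))
  refine ⟨Ideal.span (Set.range f), ?_, ?_⟩
  · rintro y ⟨A, H', g, rfl, hA, hL, hy⟩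
    exact Ideal.mem_of_dvd _ hy (Ideal.subset_span ⟨⟨(A, g), hA, hL⟩, rfl⟩)
  · refine (Ideal.FG.isNilpotent_iff_le_nilradical
      (Submodule.fg_span (Set.finite_range f))).2 (Ideal.span_le.2 ?_)
    rintro _ ⟨p, rfl⟩
    exact T.isNilpotent_nm _ ((hx.map (T.conj p.1.2 rfl)).map (T.res p.2.1))

end NormSystem

/-! ### The levelwise nilradical, primes and maximal proper ideals -/

namespace TambaraIdeal

variable {G : Type u} [Group G] {T : TambaraFunctor.{u, v} G}

theorem pow_mem_npow (I : TambaraIdeal T) {H : Subgroup G} {x : T.obj H} (hx : x ∈ I.carrier H)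
    (n : ℕ) : x ^ n ∈ (I.npow n).carrier H := by
  induction n with
  | zero => exact mem_top _
  | succ n ih =>
    rw [pow_succ]
    exact mul_mem ih hx

theorem IsPrime.le_of_npow_le {P I : TambaraIdeal T} (hP : P.IsPrime) {n : ℕ}
    (h : I.npow n ≤ P) : I ≤ P := by
  induction n with
  | zero => exact absurd (h ⊤ (mem_top 1)) hP.one_notMem
  | succ n ih => exact (hP.le_or_le _ _ h).elim ih id

theorem eq_top_of_one_mem {I : TambaraIdeal T} (h : (1 : T.obj ⊤) ∈ I.carrier ⊤) : I = ⊤ := by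
  refine le_antisymm (fun _ x _ => mem_top x) fun H x _ => ?_
  have h1 : (1 : T.obj H) ∈ I.carrier H := by
    rw [← map_one (T.res (le_top : H ≤ ⊤))]
    exact I.res_mem le_top h
  exact (Ideal.eq_top_iff_one _).2 h1 ▸ Submodule.mem_top

theorem top_npow (n : ℕ) : (⊤ : TambaraIdeal T).npow n = ⊤ := by
  refine eq_top_of_one_mem ?_
  have := pow_mem_npow (⊤ : TambaraIdeal T) (mem_top (1 : T.obj ⊤)) n
  rwa [one_pow] at this

/-- The levelwise union of a nonempty chain. -/
def chainUnion (c : Set (TambaraIdeal T)) (hc : IsChain (· ≤ ·) c) (hne : c.Nonempty) :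
    TambaraIdeal T where
  carrier H :=
    { carrier := {x | ∃ I ∈ c, x ∈ I.carrier H}
      zero_mem' := hne.imp fun I hI => ⟨hI, zero_mem _⟩
      add_mem' := by
        rintro x y ⟨I, hI, hx⟩ ⟨J, hJ, hy⟩
        obtain ⟨K, hK, hIK, hJK⟩ := hc.directedOn I hI J hJ
        exact ⟨K, hK, add_mem (hIK H hx) (hJK H hy)⟩
      smul_mem' := by
        rintro r x ⟨I, hI, hx⟩
        exact ⟨I, hI, Submodule.smul_mem _ r hx⟩ }
  res_mem := fun h _ ⟨I, hI, hx⟩ => ⟨I, hI, I.res_mem h hx⟩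
  tr_mem := fun h _ ⟨I, hI, hx⟩ => ⟨I, hI, I.tr_mem h hx⟩
  nm_mem := fun h _ ⟨I, hI, hx⟩ => ⟨I, hI, I.nm_mem h hx⟩
  conj_mem_iff := fun g _ _ h _ =>
    ⟨fun ⟨I, hI, hx⟩ => ⟨I, hI, (I.conj_mem_iff g h).1 hx⟩,
      fun ⟨I, hI, hx⟩ => ⟨I, hI, (I.conj_mem_iff g h).2 hx⟩⟩

variable [Finite G]

/-- The power $\langle x\rangle^n$ lies in the ideal spanned by transfers of $n$-fold products from
`generatedBy x`, and these products vanish for large $n$. -/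
theorem exists_span_npow_le_bot {H : Subgroup G} {x : T.obj H} (hx : IsNilpotent x) :
    ∃ n, 1 ≤ n ∧ (span x).npow n ≤ ⊥ := by
  choose J hJ m hm using NormSystem.exists_isNilpotent_ideal_generatedBy hx
  -- The nilpotency exponent `m L` depends on the level; as $G$ has finitely many subgroups, one
  -- bound serves for all. Passing to $n+1$ ensures that the exponent is at least $1$.
  obtain ⟨n, hn⟩ := (Set.finite_range m).bddAbove
  refine ⟨n + 1, by omega, ?_⟩
  refine (npow_mono (span_le.2
    (NormSystem.mem_transferIdeal _ (NormSystem.self_mem_generatedBy x))) _).trans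
    ((NormSystem.npow_transferIdeal_le _ _).trans fun K =>
      NormSystem.transferSpan_le _ fun {L} hL d hd => ?_)
  have hd := NormSystem.npow_subset _ (hJ L) _ hd
  have hmn : m L ≤ n + 1 := (hn ⟨L, rfl⟩).trans (by omega)
  rw [pow_eq_zero_of_le hmn (hm L)] at hd
  have hd0 : d = 0 := hd
  rw [hd0, map_zero]
  exact zero_mem _

theorem nilradical_carrier (H : Subgroup G) :
    T.nilradical.carrier H = nilradical (T.obj H) := by
  ext x
  rw [mem_nilradical]
  exact ⟨fun ⟨n, _, hn⟩ => ⟨n, hn H (pow_mem_npow _ (mem_span x) n)⟩, exists_span_npow_le_bot⟩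

theorem nilradical_le {I : TambaraIdeal T} (hI : I.IsRadical) : T.nilradical ≤ I := by
  rintro H x ⟨n, hn, hx⟩
  rw [hI]
  exact ⟨n, hn, hx.trans fun K y hy => (show y = 0 from hy) ▸ zero_mem _⟩

theorem IsPrime.isRadical {P : TambaraIdeal T} (hP : P.IsPrime) : P.IsRadical :=
  le_antisymm (le_radical _) fun _ _ ⟨_, _, hx⟩ => span_le.1 (hP.le_of_npow_le hx)

theorem one_mem_of_one_mem_radical {I : TambaraIdeal T}
    (h : (1 : T.obj ⊤) ∈ I.radical.carrier ⊤) : (1 : T.obj ⊤) ∈ I.carrier ⊤ := by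
  obtain ⟨n, _, hn⟩ := h
  rw [eq_top_of_one_mem (mem_span (1 : T.obj ⊤)), top_npow] at hn
  exact hn ⊤ (mem_top 1)

theorem exists_isRadical_ge {I : TambaraIdeal T} (hI : (1 : T.obj ⊤) ∉ I.carrier ⊤) :
    ∃ M : TambaraIdeal T, I ≤ M ∧ M.IsRadical ∧ (1 : T.obj ⊤) ∉ M.carrier ⊤ := by
  obtain ⟨M, hIM, hM⟩ := zorn_le_nonempty₀ {M : TambaraIdeal T | (1 : T.obj ⊤) ∉ M.carrier ⊤}
    (fun c hcs hc y hy => ⟨chainUnion c hc ⟨y, hy⟩, fun ⟨J, hJ, h⟩ => hcs hJ h,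
      fun J hJ H x hx => ⟨J, hJ, hx⟩⟩) I hI
  -- The radical of a proper ideal is proper, so the maximal $M$ equals its radical.
  exact ⟨M, hIM, le_antisymm (le_radical M)
    (hM.le_of_ge (fun h => hM.prop (one_mem_of_one_mem_radical h)) (le_radical M)), hM.prop⟩

end TambaraIdeal

/-! ### Joins and meets of radical ideals -/

namespace RadicalTambaraIdeal

variable {G : Type u} [Group G] [Finite G] {T : TambaraFunctor.{u, v} G}

theorem inf_carrier (I J : RadicalTambaraIdeal T) (H : Subgroup G) :
    (I ⊓ J).1.carrier H = I.1.carrier H ⊓ J.1.carrier H := by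
  refine le_antisymm (le_inf ((inf_le_left : I ⊓ J ≤ I) H) ((inf_le_right : I ⊓ J ≤ J) H))
    fun x hx => ?_
  have h : sInf {I, J} ≤ I ⊓ J := le_inf (sInf_le (by simp)) (sInf_le (by simp))
  refine h H (TambaraIdeal.mem_sInf.2 ?_)
  rintro _ ⟨K, rfl | rfl, rfl⟩
  exacts [hx.1, hx.2]

theorem sup_eq_top_iff (I J : RadicalTambaraIdeal T) :
    I ⊔ J = ⊤ ↔ ∀ H, I.1.carrier H ⊔ J.1.carrier H = ⊤ := by
  constructor
  · intro h
    have h1 : (1 : T.obj ⊤) ∈ (I.1.add J.1).carrier ⊤ := by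
      -- The join is only the least radical ideal above both, which could exceed $I+J$; a proper
      -- radical ideal containing $I+J$ would still bound it.
      by_contra h1
      obtain ⟨M, hM, hrad, hM1⟩ := TambaraIdeal.exists_isRadical_ge h1
      have hle : I ⊔ J ≤ ⟨M, hrad⟩ :=
        sup_le ((I.1.le_add_left' J.1).trans hM) ((I.1.le_add_right' J.1).trans hM)
      rw [h] at hle
      exact hM1 (hle ⊤ (TambaraIdeal.mem_top 1))
    intro H
    exact congrArg (fun A : TambaraIdeal T => A.carrier H) (TambaraIdeal.eq_top_of_one_mem h1)
  · intro h
    refine top_le_iff.1 fun H => ?_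
    exact (h H).ge.trans (sup_le ((le_sup_left : I ≤ I ⊔ J) H) ((le_sup_right : J ≤ I ⊔ J) H))

theorem inf_eq_nilradical_iff (I J : RadicalTambaraIdeal T) :
    (I ⊓ J).1 = T.nilradical ↔
      ∀ H, I.1.carrier H ⊓ J.1.carrier H = nilradical (T.obj H) := by
  simp only [TambaraIdeal.ext_iff, funext_iff, inf_carrier, TambaraIdeal.nilradical_carrier]

theorem isCompl_of_sup_inf {I J : RadicalTambaraIdeal T} (h : I ⊔ J = ⊤)
    (h' : (I ⊓ J).1 = T.nilradical) : IsCompl I J := by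
  refine IsCompl.of_eq (le_bot_iff.1 ?_) h
  change (I ⊓ J).1 ≤ (⊥ : RadicalTambaraIdeal T).1
  rw [h']
  exact TambaraIdeal.nilradical_le (⊥ : RadicalTambaraIdeal T).2

end RadicalTambaraIdeal

/-! ### Closed and complementary zero loci -/

namespace NakaokaSpec

variable {G : Type u} [Group G] {T : TambaraFunctor.{u, v} G}

theorem isClosed_zeroLocus (I : TambaraIdeal T) : IsClosed (zeroLocus I) := by
  have : zeroLocus I = ⋂ (H : Subgroup G) (x ∈ I.carrier H),
      {P : NakaokaSpec T | x ∈ P.1.carrier H} := by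
    ext P
    simp only [Set.mem_iInter]
    rfl
  rw [this]
  exact isClosed_iInter fun H => isClosed_iInter fun x => isClosed_iInter fun _ =>
    ⟨TopologicalSpace.isOpen_generateFrom_of_mem ⟨H, x, rfl⟩⟩

theorem isCompl_zeroLocus [Finite G] {I J : RadicalTambaraIdeal T} (h : I ⊔ J = ⊤)
    (h' : (I ⊓ J).1 = T.nilradical) : IsCompl (zeroLocus I.1) (zeroLocus J.1) := by
  refine ⟨Set.disjoint_left.2 fun P hI hJ => ?_, codisjoint_iff.2 (Set.eq_univ_of_forall fun P => ?_)⟩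
  · have := (RadicalTambaraIdeal.sup_eq_top_iff I J).1 h ⊤
    exact P.2.one_notMem (sup_le (hI ⊤) (hJ ⊤) (this.ge Submodule.mem_top))
  -- Primality applies because $IJ\subseteq I\cap J=\mathfrak N(T)\subseteq P$, the last inclusion
  -- since primes are radical.
  · refine P.2.le_or_le _ _ (TambaraIdeal.mul_le.2 fun H x hx y hy => ?_)
    refine TambaraIdeal.nilradical_le P.2.isRadical H ?_
    rw [← h', RadicalTambaraIdeal.inf_carrier]
    exact ⟨Ideal.mul_mem_right _ _ hx, Ideal.mul_mem_left _ _ hy⟩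

end NakaokaSpec

theorem exists_homeomorph_sum_of_isCompl {X : Type*} [TopologicalSpace X] {A B : Set X}
    (h : IsCompl A B) (hA : IsOpen A) (hB : IsOpen B) :
    ∃ e : (A ⊕ B) ≃ₜ X, (∀ a, e (Sum.inl a) = a.1) ∧ ∀ b, e (Sum.inr b) = b.1 := by
  have hbij : Function.Bijective (Sum.elim (Subtype.val : A → X) (Subtype.val : B → X)) := by
    refine ⟨Function.Injective.sumElim Subtype.val_injective Subtype.val_injective
      fun a b hab => Set.disjoint_left.1 h.disjoint a.2 (hab ▸ b.2), fun x => ?_⟩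
    rcases h.sup_eq_top.ge (Set.mem_univ x) with hx | hx
    exacts [⟨Sum.inl ⟨x, hx⟩, rfl⟩, ⟨Sum.inr ⟨x, hx⟩, rfl⟩]
  exact ⟨(Equiv.ofBijective _ hbij).toHomeomorphOfContinuousOpen
    (continuous_subtype_val.sumElim continuous_subtype_val)
    (hA.isOpenMap_subtype_val.sumElim hB.isOpenMap_subtype_val), fun _ => rfl, fun _ => rfl⟩

/-! ### The Chinese remainder isomorphism -/

namespace TambaraFunctor

variable {G : Type u} [Group G] [Finite G] {T : TambaraFunctor.{u, v} G}

/-- The morphism `T / N → (T / I) × (T / J)`, for `N ⊆ I, J`. -/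
def quotientToProd {N I J : TambaraIdeal T} (hI : N ≤ I) (hJ : N ≤ J) :
    TambaraData.Hom (T.quotient N).toTambaraData
      ((T.quotient I).prod (T.quotient J)).toTambaraData where
  map H := (Ideal.Quotient.factor (hI H)).prod (Ideal.Quotient.factor (hJ H))
  map_res := by
    rintro K H h ⟨x⟩
    rfl
  map_tr := by
    rintro K H h ⟨x⟩
    rfl
  map_nm := by
    rintro K H h ⟨x⟩
    rfl
  map_conj := by
    rintro g H H' h ⟨x⟩
    rfl

theorem quotientToProd_bijective {N I J : TambaraIdeal T} (hI : N ≤ I) (hJ : N ≤ J)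
    {H : Subgroup G} (hsup : I.carrier H ⊔ J.carrier H = ⊤)
    (hinf : I.carrier H ⊓ J.carrier H = N.carrier H) :
    Function.Bijective ((quotientToProd hI hJ).map H) := by
  constructor
  · refine (injective_iff_map_eq_zero _).2 ?_
    rintro ⟨x⟩ hx
    have h1 := Ideal.Quotient.eq_zero_iff_mem.1 (congrArg Prod.fst hx)
    have h2 := Ideal.Quotient.eq_zero_iff_mem.1 (congrArg Prod.snd hx)
    exact Ideal.Quotient.eq_zero_iff_mem.2 (hinf.le ⟨h1, h2⟩)
  · rintro ⟨⟨x⟩, ⟨y⟩⟩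
    obtain ⟨a, ha, b, hb, hab⟩ := Submodule.mem_sup.1 (hsup.ge (Submodule.mem_top (x := 1)))
    -- Since $a+b=1$ with $a\in I$ and $b\in J$, $b$ is $1$ modulo $I$ and $0$ modulo $J$, and $a$
    -- the reverse.
    refine ⟨Ideal.Quotient.mk _ (b * x + a * y), Prod.ext (Ideal.Quotient.eq.2 ?_)
      (Ideal.Quotient.eq.2 ?_)⟩
    · rw [show b * x + a * y - x = a * (y - x) + (a + b - 1) * x by ring, hab]
      simpa using Ideal.mul_mem_right (y - x) _ ha
    · rw [show b * x + a * y - y = b * (x - y) + (a + b - 1) * y by ring, hab]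
      simpa using Ideal.mul_mem_right (x - y) _ hb

end TambaraFunctor

theorem mainTheorem10 {G : Type u} [Group G] [Finite G] (T : TambaraFunctor.{u, v} G)
    (I J : RadicalTambaraIdeal T) :
    -- the frame-theoretic hypothesis is equivalent to the levelwise one
    ((I ⊔ J = ⊤ ∧ (I ⊓ J).1 = T.nilradical) ↔
      ∀ H : Subgroup G, I.1.carrier H ⊔ J.1.carrier H = ⊤ ∧
        I.1.carrier H ⊓ J.1.carrier H = nilradical (T.obj H)) ∧
    (I ⊔ J = ⊤ → (I ⊓ J).1 = T.nilradical →
      -- (i)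
      IsCompl I J ∧
      -- (ii)
      (IsClopen (NakaokaSpec.zeroLocus I.1) ∧ IsClopen (NakaokaSpec.zeroLocus J.1) ∧
        IsCompl (NakaokaSpec.zeroLocus I.1) (NakaokaSpec.zeroLocus J.1) ∧
        ∃ e : (NakaokaSpec.zeroLocus I.1 ⊕ NakaokaSpec.zeroLocus J.1) ≃ₜ NakaokaSpec T,
          (∀ P, e (Sum.inl P) = P.1) ∧ ∀ P, e (Sum.inr P) = P.1) ∧
      -- (iii)
      ∃ φ : TambaraFunctor.Iso T.reduction ((T.quotient I.1).prod (T.quotient J.1)),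
        ∀ (H : Subgroup G) (x : T.obj H),
          φ.map H ((T.toQuotient T.nilradical).map H x) =
            ((T.toQuotient I.1).map H x, (T.toQuotient J.1).map H x)) := by
  refine ⟨?_, fun h h' => ?_⟩
  · rw [RadicalTambaraIdeal.sup_eq_top_iff, RadicalTambaraIdeal.inf_eq_nilradical_iff,
      ← forall_and]
  · have hV := NakaokaSpec.isCompl_zeroLocus h h'
    have hI := NakaokaSpec.isClosed_zeroLocus I.1
    have hJ := NakaokaSpec.isClosed_zeroLocus J.1
    have hIo : IsOpen (NakaokaSpec.zeroLocus I.1) := hV.symm.compl_eq ▸ hJ.isOpen_compl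
    have hJo : IsOpen (NakaokaSpec.zeroLocus J.1) := hV.compl_eq ▸ hI.isOpen_compl
    refine ⟨RadicalTambaraIdeal.isCompl_of_sup_inf h h', ⟨⟨hI, hIo⟩, ⟨hJ, hJo⟩, hV,
      exists_homeomorph_sum_of_isCompl hV hIo hJo⟩,
      ⟨TambaraFunctor.quotientToProd (TambaraIdeal.nilradical_le I.2)
        (TambaraIdeal.nilradical_le J.2), fun H =>
        TambaraFunctor.quotientToProd_bijective _ _
          ((RadicalTambaraIdeal.sup_eq_top_iff I J).1 h H) ?_⟩, fun _ _ => rfl⟩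
    rw [← h', RadicalTambaraIdeal.inf_carrier]
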